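/- Let $n\ge 1$, $\Omega=(0,1)^n$, $\alpha>0$ and $\beta\in(\tfrac12,1)$. Let $\omega_\alpha=\{i^{-\alpha}: i=1,2,\dots\}$ and $\omega=\omega_\alpha^n=\omega_\alpha\times\cdots\times\omega_\alpha\subset\mathbb R^n$; this set is countable and has Hausdorff dimension $0$. Let $(\varphi_k)_{k\ge1}$ be an orthonormal basis of $L^2(\Omega)$ consisting of eigenfunctions of the Dirichlet Laplacian, $-\Delta\varphi_k=\lambda_k\varphi_k$, $\varphi_k\in H^1_0(\Omega)$, and for $\Lambda>0$ let $\Pi_\Lambda u=\sum_{\lambda_k\le\Lambda}\langle u,\varphi_k\rangle_{L^2(\Omega)}\varphi_k$. Functions are real-valued, and $\Pi_\Lambda u$ and, for $t>0$, the solution $u(t,\cdot)$ below are identified with their representatives that are continuous in $\Omega$ and vanish outside $\Omega$. (1) There exists $C>0$, depending only on $n,\alpha,\beta$, such that the spectral inequality $$\|\Pi_\Lambda u\|_{L^2(\Omega)}\le C\exp(C\Lambda^\beta)\,\sup_{x\in\omega}|\Pi_\Lambda u(x)|\qquad\text{holds for all }\Lambda>0\text{ and all }u\in L^2(\Omega).$$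 (2) There exists $C>0$, depending only on $n,\alpha,\beta$, such that for every $T>0$ and every $u_0\in L^2(\Omega)$, the heat equation $\partial_tu-\Delta u=0$ in $(0,T)\times\Omega$, $u=0$ on $(0,T)\times\partial\Omega$, $u(0,\cdot)=u_0$ has a weak solution $u\in L^2(0,T;H^1_0(\Omega))\cap H^1(0,T;H^{-1}(\Omega))\cap C([0,T];L^2(\Omega))$, and every such solution satisfies $$\|u(T,\cdot)\|_{L^\infty(\Omega)}\le C\exp\!\left(\frac{C}{T^{\beta/(1-\beta)}}\right)\int_0^T\sup_{x\in\omega}|u(t,x)|\,dt,$$ where the right-hand side may be $+\infty$. -/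

import Mathlib

open MeasureTheory Set Topology
open scoped ENNReal ContDiff RealInnerProductSpace

noncomputable section

namespace HeatObs

/-- Euclidean space `ℝⁿ`. -/
abbrev E (n : ℕ) : Type := EuclideanSpace ℝ (Fin n)

/-- The real Hilbert space `L²(Ω)`. -/
abbrev L2 {n : ℕ} (Ω : Set (E n)) : Type := Lp ℝ 2 (volume.restrict Ω)

/-- The real Hilbert space `L²(Ω; ℝⁿ)` of square integrable vector fields. -/
abbrev L2vec {n : ℕ} (Ω : Set (E n)) : Type := Lp (E n) 2 (volume.restrict Ω)

/-- `L²(Ω) × L²(Ω; ℝⁿ)` with the Hilbert norm `(‖f‖² + ‖g‖²)^{1/2}`. A Sobolev function `f` is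
recorded as the pair `(f, ∇f)`, so that this norm is the `H¹` norm. -/
abbrev Pair {n : ℕ} (Ω : Set (E n)) : Type := WithLp 2 (L2 Ω × L2vec Ω)

/-- Test functions on an open set `Ω`: smooth, with compact support contained in `Ω`. -/
def IsTest {V : Type*} [NormedAddCommGroup V] [NormedSpace ℝ V] (Ω : Set V) (ψ : V → ℝ) : Prop :=
  ContDiff ℝ ∞ ψ ∧ HasCompactSupport ψ ∧ tsupport ψ ⊆ Ω

theorem IsTest.zero {V : Type*} [NormedAddCommGroup V] [NormedSpace ℝ V] (Ω : Set V) :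
    IsTest Ω (fun _ : V => (0 : ℝ)) := by
  have h : tsupport (fun _ : V => (0 : ℝ)) = ∅ := tsupport_eq_empty_iff.2 rfl
  exact ⟨contDiff_const, HasCompactSupport.zero, by simp [h]⟩

theorem IsTest.add {V : Type*} [NormedAddCommGroup V] [NormedSpace ℝ V] {Ω : Set V} {ψ χ : V → ℝ}
    (hψ : IsTest Ω ψ) (hχ : IsTest Ω χ) : IsTest Ω (fun x => ψ x + χ x) :=
  ⟨hψ.1.add hχ.1, hψ.2.1.add hχ.2.1,
    (tsupport_add ψ χ).trans (union_subset hψ.2.2 hχ.2.2)⟩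

theorem IsTest.const_mul {V : Type*} [NormedAddCommGroup V] [NormedSpace ℝ V] {Ω : Set V}
    {ψ : V → ℝ} (c : ℝ) (hψ : IsTest Ω ψ) : IsTest Ω (fun x => c * ψ x) :=
  ⟨contDiff_const.mul hψ.1, hψ.2.1.mul_left (f := fun _ => c),
    (tsupport_mul_subset_right (f := fun _ => c)).trans hψ.2.2⟩

/-- The space of pairs `(ψ, ∇ψ)` with `ψ ∈ C_c^∞(Ω)`. -/
def testPairs {n : ℕ} (Ω : Set (E n)) : Submodule ℝ (Pair Ω) where
  carrier := {p | ∃ ψ : E n → ℝ, IsTest Ω ψ ∧ p.fst =ᵐ[volume.restrict Ω] ψ ∧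
    p.snd =ᵐ[volume.restrict Ω] gradient ψ}
  zero_mem' := by
    refine ⟨fun _ => 0, IsTest.zero Ω, Lp.coeFn_zero _ _ _, ?_⟩
    filter_upwards [Lp.coeFn_zero (E n) 2 (volume.restrict Ω)] with x hx
    simpa [gradient] using hx
  add_mem' := by
    rintro p q ⟨ψ, hψ, h1, h2⟩ ⟨χ, hχ, h3, h4⟩
    refine ⟨_, hψ.add hχ, ?_, ?_⟩
    · filter_upwards [Lp.coeFn_add p.fst q.fst, h1, h3] with x hx ha hb
      simpa [ha, hb] using hx
    · filter_upwards [Lp.coeFn_add p.snd q.snd, h2, h4] with x hx ha hb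
      have d1 : DifferentiableAt ℝ ψ x := (hψ.1.differentiable (by simp)) x
      have d2 : DifferentiableAt ℝ χ x := (hχ.1.differentiable (by simp)) x
      have e : gradient (fun x => ψ x + χ x) x = gradient ψ x + gradient χ x := by
        simp [gradient, fderiv_fun_add d1 d2]
      rw [e, ← ha, ← hb]
      exact hx
  smul_mem' := by
    rintro c p ⟨ψ, hψ, h1, h2⟩
    refine ⟨_, hψ.const_mul c, ?_, ?_⟩
    · filter_upwards [Lp.coeFn_smul c p.fst, h1] with x hx ha
      simpa [ha] using hx
    · filter_upwards [Lp.coeFn_smul c p.snd, h2] with x hx ha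
      have d1 : DifferentiableAt ℝ ψ x := (hψ.1.differentiable (by simp)) x
      have e : gradient (fun x => c * ψ x) x = c • gradient ψ x := by
        simp [gradient, fderiv_const_mul d1]
      rw [e, ← ha]
      exact hx

/-- The Sobolev space `H¹₀(Ω)`: the closure of `C_c^∞(Ω)` in the `H¹` norm. For `v : H10 Ω`,
`v.1.fst` is the function and `v.1.snd` is its weak gradient. -/
def H10 {n : ℕ} (Ω : Set (E n)) : Submodule ℝ (Pair Ω) := (testPairs Ω).topologicalClosure

/-- The space `H⁻¹(Ω)`, the dual of `H¹₀(Ω)`. -/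
abbrev Hneg1 {n : ℕ} (Ω : Set (E n)) : Type := StrongDual ℝ (H10 Ω)

/-- `φ ∈ H¹₀(Ω)` and `-Δφ = lam φ` in `Ω` (weakly), i.e. `φ` is zero or an eigenfunction of the
Dirichlet Laplacian of `Ω` with eigenvalue `lam`. -/
def IsDirichletEigen {n : ℕ} (Ω : Set (E n)) (lam : ℝ) (φ : L2 Ω) : Prop :=
  ∃ p : H10 Ω, p.1.fst = φ ∧ ∀ v : H10 Ω, ⟪p.1.snd, v.1.snd⟫ = lam * ⟪φ, v.1.fst⟫

/-- The closed linear span of the Dirichlet eigenfunctions with eigenvalue at most `Lam`. -/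
def spectralSpace {n : ℕ} (Ω : Set (E n)) (Lam : ℝ) : Submodule ℝ (L2 Ω) :=
  (Submodule.span ℝ {φ : L2 Ω | ∃ lam ≤ Lam, IsDirichletEigen Ω lam φ}).topologicalClosure

instance {n : ℕ} (Ω : Set (E n)) (Lam : ℝ) : CompleteSpace (spectralSpace Ω Lam) :=
  (Submodule.isClosed_topologicalClosure _).completeSpace_coe

/-- The spectral projector `Π_Λ`: the orthogonal projection of `L²(Ω)` onto the closed span of the
Dirichlet eigenfunctions with eigenvalue at most `Λ`. See `hasSum_spectralProj`: it is
`∑_{λ_k ≤ Λ} ⟨u, φ_k⟩ φ_k` for any orthonormal basis of eigenfunctions. -/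
def spectralProj {n : ℕ} (Ω : Set (E n)) (Lam : ℝ) (u : L2 Ω) : L2 Ω :=
  (spectralSpace Ω Lam).starProjection u

theorem IsDirichletEigen.inner_eq_zero {n : ℕ} {Ω : Set (E n)} {lam mu : ℝ} {φ χ : L2 Ω}
    (hφ : IsDirichletEigen Ω lam φ) (hχ : IsDirichletEigen Ω mu χ) (h : lam ≠ mu) :
    ⟪φ, χ⟫ = 0 := by
  obtain ⟨p, rfl, hp⟩ := hφ
  obtain ⟨q, rfl, hq⟩ := hχ
  have h1 := hp q
  have h2 := hq p
  rw [real_inner_comm, h1, real_inner_comm p.1.fst] at h2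
  exact (mul_eq_zero.1 (by linarith : (lam - mu) * ⟪p.1.fst, q.1.fst⟫ = 0)).resolve_left
    (sub_ne_zero.2 h)

/-- `Π_Λ u = ∑_{λ_k ≤ Λ} ⟨u, φ_k⟩ φ_k` for every orthonormal basis of Dirichlet eigenfunctions. -/
theorem hasSum_spectralProj {n : ℕ} {Ω : Set (E n)} {ι : Type*} (φ : HilbertBasis ι ℝ (L2 Ω))
    (lam : ι → ℝ) (h : ∀ k, IsDirichletEigen Ω (lam k) (φ k)) (Lam : ℝ) (u : L2 Ω) :
    HasSum (fun k : ι => ({k | lam k ≤ Lam}.indicator (fun k => ⟪φ k, u⟫ • φ k) k))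
      (spectralProj Ω Lam u) := by
  have hs := (φ.hasSum_repr u).mapL (spectralSpace Ω Lam).starProjection
  change HasSum _ ((spectralSpace Ω Lam).starProjection u)
  convert hs using 2 with k
  rw [map_smul, φ.repr_apply_apply]
  by_cases hk : lam k ≤ Lam
  · rw [indicator_of_mem (by exact hk), Submodule.starProjection_eq_self_iff.2]
    exact Submodule.le_topologicalClosure _ (Submodule.subset_span ⟨_, hk, h k⟩)
  · rw [indicator_of_notMem (by exact hk)]
    have : φ k ∈ (spectralSpace Ω Lam)ᗮ := by
      rw [spectralSpace, Submodule.orthogonal_closure]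
      refine (Submodule.mem_orthogonal _ _).2 fun v hv => ?_
      induction hv using Submodule.span_induction with
      | mem v hv =>
        obtain ⟨m, hm, hv⟩ := hv
        exact hv.inner_eq_zero (h k) (by intro e; exact hk (e ▸ hm))
      | zero => simp
      | add x y _ _ hx hy => rw [inner_add_left, hx, hy, add_zero]
      | smul c x _ hx => rw [real_inner_smul_left, hx, mul_zero]
    rw [(Submodule.starProjection_apply_eq_zero_iff _).2 this, smul_zero]

/-- `g` is the pointwise representative of `f ∈ L²(Ω)`: it is continuous on `Ω`, agrees with `f`
almost everywhere in `Ω`, and is extended by zero outside `Ω` (Dirichlet boundary values). -/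
def IsPointwiseRep {n : ℕ} (Ω : Set (E n)) (f : L2 Ω) (g : E n → ℝ) : Prop :=
  ContinuousOn g Ω ∧ f =ᵐ[volume.restrict Ω] g ∧ ∀ x ∉ Ω, g x = 0

theorem IsPointwiseRep.unique {n : ℕ} {Ω : Set (E n)} (hΩ : IsOpen Ω) {f : L2 Ω} {g h : E n → ℝ}
    (hg : IsPointwiseRep Ω f g) (hh : IsPointwiseRep Ω f h) : g = h := by
  have e : EqOn g h Ω :=
    Measure.eqOn_open_of_ae_eq (hg.2.1.symm.trans hh.2.1) hΩ hg.1 hh.1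
  funext x
  by_cases hx : x ∈ Ω
  · exact e hx
  · rw [hg.2.2 x hx, hh.2.2 x hx]

/-- The spectral inequality `spec(Ω, obs, C, β)`:
`‖Π_Λ u‖_{L²(Ω)} ≤ C exp(C Λ^β) sup_{x ∈ obs} |Π_Λ u (x)|` for all `Λ > 0` and `u ∈ L²(Ω)`, where
`Π_Λ u` on the right is the continuous function representing it. -/
def SpecIneq {n : ℕ} (Ω obs : Set (E n)) (C β : ℝ) : Prop :=
  ∀ Lam : ℝ, 0 < Lam → ∀ u : L2 Ω, ∃ g : E n → ℝ, IsPointwiseRep Ω (spectralProj Ω Lam u) g ∧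
    ‖spectralProj Ω Lam u‖ₑ ≤ ENNReal.ofReal (C * Real.exp (C * Lam ^ β)) * ⨆ x ∈ obs, ‖g x‖ₑ

/-- `u` is the weak solution on `[0, T]` of `∂_t u - Δu = 0` in `Ω`, `u = 0` on `∂Ω`,
`u(0) = u₀`. That is, `u ∈ C([0,T]; L²(Ω))`, `u(0) = u₀`, `u ∈ L²(0,T; H¹₀(Ω))` (as `U`), the
distributional time derivative of `u` is in `L²(0,T; H⁻¹(Ω))` (as `U'`), and for every
`v ∈ H¹₀(Ω)`, `⟨u'(t), v⟩ + ∫_Ω ∇u(t)·∇v = 0` for almost every `t ∈ (0,T)`. -/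
def IsHeatSolution {n : ℕ} (Ω : Set (E n)) (T : ℝ) (u₀ : L2 Ω) (u : ℝ → L2 Ω) : Prop :=
  ContinuousOn u (Icc 0 T) ∧ u 0 = u₀ ∧
  ∃ (U : ℝ → H10 Ω) (U' : ℝ → Hneg1 Ω),
    MemLp U 2 (volume.restrict (Ioo 0 T)) ∧
    MemLp U' 2 (volume.restrict (Ioo 0 T)) ∧
    (∀ᵐ t ∂(volume.restrict (Ioo 0 T)), (U t).1.fst = u t) ∧
    (∀ θ : ℝ → ℝ, IsTest (Ioo 0 T) θ → ∀ v : H10 Ω,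
      ∫ t in Ioo 0 T, deriv θ t * ⟪(U t).1.fst, v.1.fst⟫ = -∫ t in Ioo 0 T, θ t * U' t v) ∧
    (∀ v : H10 Ω, ∀ᵐ t ∂(volume.restrict (Ioo 0 T)),
      U' t v + ⟪(U t).1.snd, v.1.snd⟫ = 0)

/-- The observability inequality `‖u(T,·)‖_{L^∞(Ω)} ≤ K ∫₀ᵀ sup_{x ∈ obs} |u(t,x)| dt` for an
`L²(Ω)`-valued function `u` on `[0,T]`, where for `0 < t ≤ T` the function `u(t,·)` on the right is
the continuous function `w t` representing `u t`. The right-hand side may be infinite. -/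
def ObsIneq {n : ℕ} (Ω obs : Set (E n)) (T K : ℝ) (u : ℝ → L2 Ω) : Prop :=
  ∃ w : ℝ → E n → ℝ, (∀ t ∈ Ioc 0 T, IsPointwiseRep Ω (u t) (w t)) ∧
    eLpNorm (u T) ∞ (volume.restrict Ω) ≤
      ENNReal.ofReal K * ∫⁻ t in Ioc 0 T, ⨆ x ∈ obs, ‖w t x‖ₑ

/-- The open unit cube `(0,1)ⁿ`. -/
def cube (n : ℕ) : Set (E n) := {x | ∀ j, x j ∈ Ioo (0 : ℝ) 1}

/-- `ω_α = {i^{-α} : i = 1, 2, …}`. -/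
def omegaSet (α : ℝ) : Set ℝ := {y | ∃ i : ℕ, 1 ≤ i ∧ y = (i : ℝ) ^ (-α)}

/-- The Cartesian power `ω_α × ⋯ × ω_α ⊆ ℝⁿ`. -/
def omegaPow (n : ℕ) (α : ℝ) : Set (E n) := {x | ∀ j, x j ∈ omegaSet α}

end HeatObs

end

/-!
The Dirichlet eigenfunctions of the unit cube are the products `∏ⱼ √2 sin (π (kⱼ + 1) xⱼ)`, so the
theorem reduces to explicit trigonometric sums.

*Spectral inequality.* In one variable, `sin ((m + 1) π x) = sin (π x) U_m (cos (π x))` with the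
Chebyshev polynomial `U_m`. A sum of the first `N` sines is therefore recovered from its values at
the `N` points `(i + 2) ^ (-α)`, `i < N`, by Lagrange interpolation in the variable `cos (π x)`
(`sin_eq_sum_sinBasis`). The gaps between these points are bounded below by a power of `1 / N`, so
the interpolation constant is at most `N ^ (O(N)) = exp (O(N log N))`, and this is
`exp (O(N ^ (2 β)))` for every `β > 1/2`; as `N ≤ √Λ`, it is `exp (O(Λ ^ β))`
(`exists_gridConst_le`). In `n` variables the interpolation formulas are multiplied. That `Π_Λ u`
is a finite sum of sine products rests on their completeness (`eq_zero_of_inner_mode_eq_zero`,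
Stone–Weierstrass in the variables `cos (π xⱼ)`) and on their being weak eigenfunctions in `H¹₀`
(`isDirichletEigen_mode`).

*Heat equation.* Testing the equation with an eigenfunction shows that the coefficients of every
weak solution are `exp (-λ_k t) ⟨u₀, φ_k⟩` (`IsHeatSolution.coef_eq`, by the lemma of
du Bois-Reymond); conversely this series is a weak solution (`isHeatSolution_heatSol`).

*Observability.* At a cutoff frequency `Λ`, the low frequencies of `u(t)` are bounded by the
spectral inequality and the high ones are damped by `exp (-Λ τ / 2)` after a time `τ`
(`enorm_heatFlow_le_obsSup`). On a time step of length `σ`, the choice `Λ ~ σ ^ (-1 / (1 - β))`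
bounds the weighted norm at the end of the step by the observation plus the weighted norm at its
beginning, with weights `exp (-D σ ^ (-β / (1 - β)))` (`weighted_enorm_le_add`). Over dyadic steps
accumulating at time `0` these bounds telescope (`weighted_enorm_le_lintegral`), and the smoothing
of the heat flow turns the `L²` bound into an `L^∞` bound.
-/

noncomputable section

namespace HeatObs

/-! ### Interpolation of trigonometric sums at the nodes `i ^ (-α)` -/

/-- The `i`-th interpolation node `(i + 2) ^ (-α)`. The point `1 ^ (-α) = 1` of `ω_α` is skipped,
because every Dirichlet eigenfunction vanishes there. -/
def node (α : ℝ) (i : ℕ) : ℝ := ((i + 2 : ℕ) : ℝ) ^ (-α)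

/-- A lower bound for the distances between any two of `1, 2 ^ (-α), …, (N + 2) ^ (-α)`. -/
def nodeSep (α : ℝ) (N : ℕ) : ℝ := α * ((N + 2 : ℕ) : ℝ) ^ (-(α + 1))

theorem nodeSep_pos {α : ℝ} (hα : 0 < α) (N : ℕ) : 0 < nodeSep α N := by
  unfold nodeSep; positivity

theorem nodeSep_le_sub {α : ℝ} (hα : 0 < α) {i j N : ℕ} (hi : 1 ≤ i) (hij : i < j)
    (hj : j ≤ N + 2) : nodeSep α N ≤ (i : ℝ) ^ (-α) - (j : ℝ) ^ (-α) := by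
  have hi0 : (0 : ℝ) < i := by exact_mod_cast hi
  have hj0 : (0 : ℝ) < j := by exact_mod_cast (by omega : 0 < j)
  have h1 : nodeSep α N ≤ α * (j : ℝ) ^ (-(α + 1)) := by
    unfold nodeSep
    refine mul_le_mul_of_nonneg_left ?_ hα.le
    exact Real.rpow_le_rpow_of_nonpos hj0 (by exact_mod_cast hj) (by linarith)
  have h2 : (i : ℝ) ^ (-α) = (j : ℝ) ^ (-α) * ((j : ℝ) / i) ^ α := by
    rw [Real.div_rpow hj0.le hi0.le, Real.rpow_neg hi0.le, Real.rpow_neg hj0.le]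
    field_simp
  have h3 : 1 + α * (1 / j) ≤ ((j : ℝ) / i) ^ α := by
    rw [Real.rpow_def_of_pos (by positivity)]
    have h4 : 1 - ((j : ℝ) / i)⁻¹ ≤ Real.log ((j : ℝ) / i) :=
      Real.one_sub_inv_le_log_of_pos (by positivity)
    have h5 : 1 / (j : ℝ) ≤ 1 - ((j : ℝ) / i)⁻¹ := by
      rw [inv_div, le_sub_iff_add_le, ← add_div, div_le_one hj0]
      exact_mod_cast (by omega : 1 + i ≤ j)
    have h6 := Real.add_one_le_exp (Real.log ((j : ℝ) / i) * α)
    nlinarith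
  have h7 : (j : ℝ) ^ (-(α + 1)) = (j : ℝ) ^ (-α) * (1 / j) := by
    rw [neg_add, Real.rpow_add hj0, Real.rpow_neg_one, one_div]
  have h8 : 0 < (j : ℝ) ^ (-α) := by positivity
  rw [h7] at h1
  rw [h2]
  nlinarith [mul_le_mul_of_nonneg_left h3 h8.le]

theorem nodeSep_le_abs_sub {α : ℝ} (hα : 0 < α) {i j N : ℕ} (hij : i ≠ j) (hi : i < N)
    (hj : j < N) : nodeSep α N ≤ |node α i - node α j| := by
  rcases lt_or_gt_of_ne hij with h | h
  · exact (nodeSep_le_sub hα (by omega) (by omega : i + 2 < j + 2) (by omega)).trans (le_abs_self _)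
  · rw [abs_sub_comm]
    exact (nodeSep_le_sub hα (by omega) (by omega : j + 2 < i + 2) (by omega)).trans (le_abs_self _)

theorem nodeSep_le_node {α : ℝ} (hα : 0 < α) {i N : ℕ} (hi : i < N) : nodeSep α N ≤ node α i := by
  have h := nodeSep_le_sub hα (by omega) (by omega : i + 2 < N + 2) le_rfl
  have : 0 ≤ ((N + 2 : ℕ) : ℝ) ^ (-α) := by positivity
  unfold node
  linarith

theorem node_le_one_sub_nodeSep {α : ℝ} (hα : 0 < α) {i N : ℕ} (hi : i < N) :
    node α i ≤ 1 - nodeSep α N := by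
  have h := nodeSep_le_sub hα le_rfl (by omega : 1 < i + 2) (by omega : i + 2 ≤ N + 2)
  rw [Nat.cast_one, Real.one_rpow] at h
  unfold node
  linarith

theorem nodeSep_le_one {α : ℝ} (hα : 0 < α) (N : ℕ) : nodeSep α N ≤ 1 := by
  have h := nodeSep_le_sub hα le_rfl (by omega : 1 < 2) (by omega : 2 ≤ N + 2)
  rw [Nat.cast_one, Real.one_rpow] at h
  have : 0 ≤ ((2 : ℕ) : ℝ) ^ (-α) := by positivity
  linarith

theorem two_mul_le_sin_pi_mul {d s : ℝ} (hd : 0 ≤ d) (h1 : d ≤ s) (h2 : s ≤ 1 - d) :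
    2 * d ≤ Real.sin (Real.pi * s) := by
  have key : ∀ r : ℝ, d ≤ r → r ≤ 1 / 2 → 2 * d ≤ Real.sin (Real.pi * r) := by
    intro r hr hr'
    have := Real.mul_le_sin (x := Real.pi * r) (by have := Real.pi_pos; nlinarith)
      (by have := Real.pi_pos; nlinarith)
    have e : 2 / Real.pi * (Real.pi * r) = 2 * r := by field_simp
    linarith
  rcases le_total s (1 / 2) with h | h
  · exact key s h1 h
  · have := key (1 - s) (by linarith) (by linarith)
    rwa [mul_sub, mul_one, Real.sin_pi_sub] at this

theorem two_mul_sq_le_abs_cos_sub_cos {a b : ℝ} (ha : a ∈ Icc (0 : ℝ) 1) (hb : b ∈ Icc (0 : ℝ) 1) :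
    2 * (a - b) ^ 2 ≤ |Real.cos (Real.pi * a) - Real.cos (Real.pi * b)| := by
  wlog hab : b ≤ a generalizing a b
  · have := this hb ha (le_of_not_ge hab)
    rw [abs_sub_comm]
    nlinarith
  rw [Real.cos_sub_cos]
  have h1 : a - b ≤ Real.sin ((Real.pi * a + Real.pi * b) / 2) := by
    have := two_mul_le_sin_pi_mul (d := (a - b) / 2) (s := (a + b) / 2) (by linarith)
      (by linarith [hb.1]) (by linarith [ha.2])
    rw [show (Real.pi * a + Real.pi * b) / 2 = Real.pi * ((a + b) / 2) by ring]
    linarith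
  have h2 : a - b ≤ Real.sin ((Real.pi * a - Real.pi * b) / 2) := by
    have := two_mul_le_sin_pi_mul (d := (a - b) / 2) (s := (a - b) / 2) (by linarith)
      le_rfl (by linarith [ha.2, hb.1])
    rw [show (Real.pi * a - Real.pi * b) / 2 = Real.pi * ((a - b) / 2) by ring]
    linarith
  refine le_trans ?_ (neg_le_abs _)
  nlinarith [mul_le_mul h1 h2 (sub_nonneg.2 hab) ((sub_nonneg.2 hab).trans h1)]

/-- The Lagrange-type basis function at the `i`-th of `N` nodes, for odd trigonometric
polynomials: the factor `sin` carries the Dirichlet condition, and what remains of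
`sin ((m + 1) π x) / sin (π x)` is a polynomial in `cos (π x)`. -/
def sinBasis (α : ℝ) (N i : ℕ) (x : ℝ) : ℝ :=
  Real.sin (Real.pi * x) / Real.sin (Real.pi * node α i) *
    ∏ j ∈ (Finset.range N).erase i, (Real.cos (Real.pi * x) - Real.cos (Real.pi * node α j)) /
      (Real.cos (Real.pi * node α i) - Real.cos (Real.pi * node α j))

theorem node_mem_Icc {α : ℝ} (hα : 0 < α) (i : ℕ) : node α i ∈ Icc (0 : ℝ) 1 :=
  ⟨by unfold node; positivity, (node_le_one_sub_nodeSep hα (Nat.lt_succ_self i)).trans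
    (by linarith [nodeSep_pos hα (i + 1)])⟩

theorem nodeSep_sq_le_abs_cos_sub {α : ℝ} (hα : 0 < α) {i j N : ℕ} (hij : i ≠ j) (hi : i < N)
    (hj : j < N) : 2 * nodeSep α N ^ 2 ≤
      |Real.cos (Real.pi * node α i) - Real.cos (Real.pi * node α j)| := by
  refine le_trans ?_ (two_mul_sq_le_abs_cos_sub_cos (node_mem_Icc hα i) (node_mem_Icc hα j))
  rw [← sq_abs (node α i - node α j)]
  have h := nodeSep_le_abs_sub hα hij hi hj
  have := nodeSep_pos hα N
  gcongr

theorem abs_sinBasis_le {α : ℝ} (hα : 0 < α) {N i : ℕ} (hi : i < N) (x : ℝ) :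
    |sinBasis α N i x| ≤ (nodeSep α N ^ 2)⁻¹ ^ N := by
  have hd := nodeSep_pos hα N
  have hd1 := nodeSep_le_one hα N
  have h1 : |Real.sin (Real.pi * x) / Real.sin (Real.pi * node α i)| ≤ (nodeSep α N ^ 2)⁻¹ := by
    have h2 := two_mul_le_sin_pi_mul hd.le (nodeSep_le_node hα hi) (node_le_one_sub_nodeSep hα hi)
    rw [abs_div, div_eq_mul_inv, ← one_mul (nodeSep α N ^ 2)⁻¹]
    refine mul_le_mul (Real.abs_sin_le_one _) ?_ (by positivity) zero_le_one
    refine inv_anti₀ (by positivity) (le_trans ?_ (le_abs_self _))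
    nlinarith
  have h3 : |∏ j ∈ (Finset.range N).erase i,
      (Real.cos (Real.pi * x) - Real.cos (Real.pi * node α j)) /
      (Real.cos (Real.pi * node α i) - Real.cos (Real.pi * node α j))| ≤
      (nodeSep α N ^ 2)⁻¹ ^ (N - 1) := by
    have hc : ((Finset.range N).erase i).card = N - 1 := by
      rw [Finset.card_erase_of_mem (Finset.mem_range.2 hi), Finset.card_range]
    rw [Finset.abs_prod, ← hc]
    rw [← Finset.prod_const]
    refine Finset.prod_le_prod (fun _ _ => abs_nonneg _) fun j hj => ?_
    have hji := Finset.ne_of_mem_erase hj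
    have hjN := Finset.mem_range.1 (Finset.mem_of_mem_erase hj)
    have h4 := nodeSep_sq_le_abs_cos_sub hα hji.symm hi hjN
    rw [abs_div, div_le_iff₀ (by nlinarith)]
    have h5 : |Real.cos (Real.pi * x) - Real.cos (Real.pi * node α j)| ≤ 2 := by
      refine (abs_sub _ _).trans ?_
      linarith [Real.abs_cos_le_one (Real.pi * x), Real.abs_cos_le_one (Real.pi * node α j)]
    refine h5.trans ?_
    rw [inv_mul_eq_div, le_div_iff₀ (by positivity)]
    linarith
  obtain ⟨M, rfl⟩ : ∃ M, N = M + 1 := ⟨N - 1, by omega⟩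
  rw [sinBasis, abs_mul, pow_succ', ← Nat.add_sub_cancel (n := M) (m := 1)]
  exact mul_le_mul h1 h3 (abs_nonneg _) (by positivity)

/-- Lagrange interpolation of the Chebyshev polynomial `U_m` at the points `cos (π node)`. -/
theorem sin_eq_sum_sinBasis {α : ℝ} (hα : 0 < α) {N m : ℕ} (hm : m < N) (x : ℝ) :
    Real.sin (Real.pi * (m + 1) * x) =
      ∑ i ∈ Finset.range N, Real.sin (Real.pi * (m + 1) * node α i) * sinBasis α N i x := by
  set v : ℕ → ℝ := fun i => Real.cos (Real.pi * node α i) with hv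
  have hinj : Set.InjOn v (Finset.range N) := by
    intro i hi j hj hij
    by_contra hne
    have h := nodeSep_sq_le_abs_cos_sub hα hne (Finset.mem_range.1 hi) (Finset.mem_range.1 hj)
    rw [show Real.cos (Real.pi * node α i) - Real.cos (Real.pi * node α j) = 0 from
      sub_eq_zero.2 hij, abs_zero] at h
    have := nodeSep_pos hα N
    nlinarith
  have hdeg : (Polynomial.Chebyshev.U ℝ (m : ℤ)).degree < (Finset.range N).card := by
    rw [Polynomial.Chebyshev.degree_U_natCast, Finset.card_range]
    exact_mod_cast hm
  have hU : ∀ y : ℝ, Real.sin (Real.pi * (m + 1) * y) =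
      (Polynomial.Chebyshev.U ℝ (m : ℤ)).eval (Real.cos (Real.pi * y)) * Real.sin (Real.pi * y) := by
    intro y
    rw [Polynomial.Chebyshev.U_real_cos]
    congr 1
    push_cast
    ring
  rw [hU x]
  conv_lhs => rw [Lagrange.eq_interpolate hinj hdeg]
  rw [Lagrange.interpolate_apply, Polynomial.eval_finsetSum, Finset.sum_mul]
  refine Finset.sum_congr rfl fun i hi => ?_
  have hs : Real.sin (Real.pi * node α i) ≠ 0 := by
    have hi := Finset.mem_range.1 hi
    have := two_mul_le_sin_pi_mul (nodeSep_pos hα N).le (nodeSep_le_node hα hi)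
      (node_le_one_sub_nodeSep hα hi)
    have := nodeSep_pos hα N
    linarith
  have hb : (Lagrange.basis (Finset.range N) v i).eval (Real.cos (Real.pi * x)) =
      ∏ j ∈ (Finset.range N).erase i, (Real.cos (Real.pi * x) - v j) / (v i - v j) := by
    rw [Lagrange.basis, Polynomial.eval_prod]
    refine Finset.prod_congr rfl fun j _ => ?_
    simp [Lagrange.basisDivisor]
    ring
  rw [Polynomial.eval_mul, Polynomial.eval_C, hb, hU, sinBasis]
  field_simp
  simp only [hv]
  ring

/-- The `k`-th Dirichlet eigenfunction of the unit cube, `∏ⱼ √2 sin (π (kⱼ + 1) xⱼ)`, as a function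
on all of `ℝⁿ`; the frequencies are shifted by one so that every `k : Fin n → ℕ` is allowed. -/
def modeFun {n : ℕ} (k : Fin n → ℕ) (x : E n) : ℝ :=
  ∏ j, √2 * Real.sin (Real.pi * (k j + 1) * x j)

/-- The point of the grid `ω_α^n` with multi-index `i`. -/
def gridPt {n : ℕ} (α : ℝ) (i : Fin n → ℕ) : E n := WithLp.toLp 2 fun j => node α (i j)

theorem gridPt_mem_omegaPow {n : ℕ} (α : ℝ) (i : Fin n → ℕ) : gridPt α i ∈ omegaPow n α :=
  fun j => ⟨i j + 2, by omega, rfl⟩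

theorem gridPt_mem_cube {n : ℕ} {α : ℝ} (hα : 0 < α) (i : Fin n → ℕ) : gridPt α i ∈ cube n :=
  fun j => ⟨(nodeSep_pos hα _).trans_le (nodeSep_le_node hα (Nat.lt_succ_self _)),
    (node_le_one_sub_nodeSep hα (Nat.lt_succ_self _)).trans_lt (by
      linarith [nodeSep_pos hα (i j + 1)])⟩

theorem modeFun_eq_sum_gridPt {n : ℕ} {α : ℝ} (hα : 0 < α) {N : ℕ} {k : Fin n → ℕ}
    (hk : ∀ j, k j < N) (x : E n) :
    modeFun k x = ∑ i ∈ Fintype.piFinset fun _ : Fin n => Finset.range N,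
      modeFun k (gridPt α i) * ∏ j, sinBasis α N (i j) (x j) := by
  simp only [modeFun, gridPt, ← Finset.prod_mul_distrib]
  rw [← Finset.prod_univ_sum (fun _ => Finset.range N)
    (fun j m => √2 * Real.sin (Real.pi * (k j + 1) * node α m) * sinBasis α N m (x j))]
  refine Finset.prod_congr rfl fun j _ => ?_
  rw [sin_eq_sum_sinBasis hα (hk j) (x j), Finset.mul_sum]
  exact Finset.sum_congr rfl fun i _ => (mul_assoc _ _ _).symm

/-- The interpolation constant: the number of grid points times the bound for the basis. -/
def gridConst (n : ℕ) (α : ℝ) (N : ℕ) : ℝ := (N * (nodeSep α N ^ 2)⁻¹ ^ N) ^ n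

/-- A trigonometric sum of frequencies at most `N` is controlled by its values on the grid. -/
theorem enorm_sum_modeFun_le {n : ℕ} {α : ℝ} (hα : 0 < α) {N : ℕ} {s : Finset (Fin n → ℕ)}
    (hs : ∀ k ∈ s, ∀ j, k j < N) (a : (Fin n → ℕ) → ℝ) (x : E n) {S : ℝ≥0∞}
    (hS : ∀ i, ‖∑ k ∈ s, a k * modeFun k (gridPt α i)‖ₑ ≤ S) :
    ‖∑ k ∈ s, a k * modeFun k x‖ₑ ≤ ENNReal.ofReal (gridConst n α N) * S := by
  have e : ∑ k ∈ s, a k * modeFun k x = ∑ i ∈ Fintype.piFinset fun _ : Fin n => Finset.range N,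
      (∑ k ∈ s, a k * modeFun k (gridPt α i)) * ∏ j, sinBasis α N (i j) (x j) := by
    simp only [Finset.sum_mul]
    rw [Finset.sum_comm]
    refine Finset.sum_congr rfl fun k hk => ?_
    rw [modeFun_eq_sum_gridPt hα (hs k hk) x, Finset.mul_sum]
    exact Finset.sum_congr rfl fun i _ => (mul_assoc _ _ _).symm
  rw [e]
  have hb : ∀ i ∈ Fintype.piFinset fun _ : Fin n => Finset.range N,
      ‖(∑ k ∈ s, a k * modeFun k (gridPt α i)) * ∏ j, sinBasis α N (i j) (x j)‖ₑ ≤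
      ENNReal.ofReal (((nodeSep α N ^ 2)⁻¹ ^ N) ^ n) * S := by
    intro i hi
    rw [enorm_mul, mul_comm]
    refine mul_le_mul' ?_ (hS i)
    rw [← ofReal_norm, Real.norm_eq_abs, Finset.abs_prod]
    refine ENNReal.ofReal_le_ofReal ?_
    calc ∏ j, |sinBasis α N (i j) (x j)| ≤ ∏ _j : Fin n, (nodeSep α N ^ 2)⁻¹ ^ N :=
          Finset.prod_le_prod (fun _ _ => abs_nonneg _) fun j _ =>
            abs_sinBasis_le hα (Finset.mem_range.1 (Fintype.mem_piFinset.1 hi j)) _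
      _ = _ := by simp
  refine (enorm_sum_le _ _).trans ((Finset.sum_le_sum hb).trans ?_)
  rw [Finset.sum_const, Fintype.card_piFinset, nsmul_eq_mul, ← mul_assoc]
  refine mul_le_mul_left (le_of_eq ?_) _
  rw [gridConst, mul_pow, ENNReal.ofReal_mul (by positivity)]
  simp

/-- The logarithm of the interpolation constant for `N` nodes is `O(N log N)`, hence `O(N^(2β))`
for every `β > 1/2`. -/
theorem exists_gridConst_le (n : ℕ) {α β : ℝ} (hα : 0 < α) (hβ : 1 / 2 < β) :
    ∃ C : ℝ, 1 ≤ C ∧ ∀ Lam : ℝ, 0 < Lam →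
      gridConst n α ⌊√Lam⌋₊ ≤ C * Real.exp (C * Lam ^ β) := by
  set ε := 2 * β - 1 with hε
  have hε0 : 0 < ε := by linarith
  set K := 1 + 2 * ((α + 1) * ((3 : ℝ) ^ ε / ε) + |Real.log α|) with hK
  have hK1 : 0 < K := by positivity
  refine ⟨n * K + 1, by nlinarith [mul_nonneg (Nat.cast_nonneg (α := ℝ) n) hK1.le],
    fun Lam hLam => ?_⟩
  have hLβ : 0 < Lam ^ β := by positivity
  have hC1 : (1 : ℝ) ≤ n * K + 1 := by nlinarith [mul_nonneg (Nat.cast_nonneg (α := ℝ) n) hK1.le]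
  have main : (⌊√Lam⌋₊ : ℝ) * (nodeSep α ⌊√Lam⌋₊ ^ 2)⁻¹ ^ ⌊√Lam⌋₊ ≤ Real.exp (K * Lam ^ β) := by
    set N := ⌊√Lam⌋₊ with hN
    rcases Nat.eq_zero_or_pos N with h0 | hpos
    · rw [h0]; simp; positivity
    have hN1 : (1 : ℝ) ≤ N := by exact_mod_cast hpos
    have hN0 : (0 : ℝ) < N := by linarith
    have hd := nodeSep_pos hα N
    rw [← Real.log_le_iff_le_exp (by positivity), Real.log_mul (by positivity) (by positivity),
      Real.log_pow, Real.log_inv, Real.log_pow]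
    have hlogd : Real.log (nodeSep α N) = Real.log α - (α + 1) * Real.log (N + 2 : ℕ) := by
      rw [nodeSep, Real.log_mul hα.ne' (by positivity), Real.log_rpow (by positivity)]
      ring
    have hNε : (N : ℝ) * N ^ ε = N ^ (2 * β) := by
      rw [show 2 * β = 1 + ε by rw [hε]; ring, Real.rpow_add hN0, Real.rpow_one]
    have hNle : (N : ℝ) ≤ N ^ (2 * β) := by
      conv_lhs => rw [← Real.rpow_one (N : ℝ)]
      exact Real.rpow_le_rpow_of_exponent_le hN1 (by linarith)
    have hlog : Real.log (N + 2 : ℕ) ≤ (3 : ℝ) ^ ε / ε * N ^ ε := by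
      refine (Real.log_le_rpow_div (by positivity) hε0).trans ?_
      rw [div_mul_eq_mul_div, ← Real.mul_rpow (by norm_num) hN0.le]
      gcongr
      push_cast
      linarith
    have hNlog : (N : ℝ) * Real.log (N + 2 : ℕ) ≤ (3 : ℝ) ^ ε / ε * N ^ (2 * β) := by
      rw [← hNε]
      nlinarith [mul_le_mul_of_nonneg_left hlog hN0.le]
    have h2β : (N : ℝ) ^ (2 * β) ≤ Lam ^ β := by
      rw [Real.rpow_mul hN0.le]
      gcongr
      rw [Real.rpow_two]
      calc (N : ℝ) ^ 2 ≤ √Lam ^ 2 := by gcongr; exact Nat.floor_le (Real.sqrt_nonneg _)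
        _ = Lam := Real.sq_sqrt hLam.le
    have hlogN : Real.log N ≤ N ^ (2 * β) :=
      ((Real.log_le_sub_one_of_pos hN0).trans (by linarith)).trans hNle
    have habs : -(N * Real.log α) ≤ |Real.log α| * N ^ (2 * β) := by
      have := neg_abs_le (Real.log α)
      have := abs_nonneg (Real.log α)
      nlinarith
    refine le_trans ?_ (mul_le_mul_of_nonneg_left h2β hK1.le)
    rw [hlogd, hK]
    have := mul_le_mul_of_nonneg_left hNlog (by linarith : (0 : ℝ) ≤ α + 1)
    push_cast at *
    nlinarith
  calc gridConst n α ⌊√Lam⌋₊ ≤ Real.exp (K * Lam ^ β) ^ n := by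
        rw [gridConst]
        have := nodeSep_pos hα ⌊√Lam⌋₊
        gcongr
    _ = Real.exp (n * K * Lam ^ β) := by rw [← Real.exp_nat_mul]; ring_nf
    _ ≤ 1 * Real.exp ((n * K + 1) * Lam ^ β) := by
        rw [one_mul]
        gcongr
        linarith
    _ ≤ (n * K + 1) * Real.exp ((n * K + 1) * Lam ^ β) := by gcongr

/-! ### The sine products are an orthonormal basis of `L²` of the cube -/

theorem cube_eq_preimage (n : ℕ) :
    cube n = (WithLp.ofLp : E n → Fin n → ℝ) ⁻¹' (univ.pi fun _ => Ioo 0 1) := by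
  ext x; simp [cube]

theorem isOpen_cube (n : ℕ) : IsOpen (cube n) := by
  rw [cube_eq_preimage]
  exact (isOpen_set_pi finite_univ fun _ _ => isOpen_Ioo).preimage (PiLp.continuous_ofLp 2 _)

theorem measurableSet_cube (n : ℕ) : MeasurableSet (cube n) := (isOpen_cube n).measurableSet

theorem volume_cube (n : ℕ) : volume (cube n) = 1 := by
  rw [cube_eq_preimage, (PiLp.volume_preserving_ofLp (Fin n)).measure_preimage
    (MeasurableSet.univ_pi fun _ => measurableSet_Ioo).nullMeasurableSet, volume_pi_pi]
  simp

instance (n : ℕ) : IsProbabilityMeasure (volume.restrict (cube n)) :=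
  ⟨by rw [Measure.restrict_apply_univ, volume_cube]⟩

theorem integral_cube_prod {n : ℕ} (f : Fin n → ℝ → ℝ) :
    ∫ x in cube n, ∏ j, f j (x j) = ∏ j, ∫ t in Ioo (0 : ℝ) 1, f j t := by
  rw [cube_eq_preimage, (PiLp.volume_preserving_ofLp (Fin n)).setIntegral_preimage_emb
    (MeasurableEquiv.toLp 2 (Fin n → ℝ)).symm.measurableEmbedding
    (fun x : Fin n → ℝ => ∏ j, f j (x j)), volume_pi, Measure.restrict_pi_pi]
  exact integral_fintype_prod_eq_prod f

theorem integral_cos_pi_int_mul (m : ℤ) :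
    ∫ t in Ioo (0 : ℝ) 1, Real.cos (Real.pi * m * t) = if m = 0 then 1 else 0 := by
  rw [← integral_Ioc_eq_integral_Ioo, ← intervalIntegral.integral_of_le zero_le_one]
  split_ifs with h
  · simp [h]
  · have hm : Real.pi * m ≠ 0 := mul_ne_zero Real.pi_ne_zero (by exact_mod_cast h)
    rw [intervalIntegral.integral_comp_mul_left (fun t => Real.cos t) hm, integral_cos]
    simp [mul_comm Real.pi, Real.sin_int_mul_pi]

theorem integral_sin_mul_sin_Ioo (a b : ℕ) :
    ∫ t in Ioo (0 : ℝ) 1, (√2 * Real.sin (Real.pi * (a + 1) * t)) *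
      (√2 * Real.sin (Real.pi * (b + 1) * t)) = if a = b then 1 else 0 := by
  have e : ∀ t : ℝ, (√2 * Real.sin (Real.pi * (a + 1) * t)) *
      (√2 * Real.sin (Real.pi * (b + 1) * t)) =
      Real.cos (Real.pi * ((a - b : ℤ) : ℝ) * t) - Real.cos (Real.pi * ((a + b + 2 : ℤ) : ℝ) * t) := by
    intro t
    have h2 : √2 * √2 = (2 : ℝ) := Real.mul_self_sqrt (by norm_num)
    rw [Real.cos_sub_cos]
    have e1 : (Real.pi * ((a - b : ℤ) : ℝ) * t + Real.pi * ((a + b + 2 : ℤ) : ℝ) * t) / 2 =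
      Real.pi * (a + 1) * t := by push_cast; ring
    have e2 : (Real.pi * ((a - b : ℤ) : ℝ) * t - Real.pi * ((a + b + 2 : ℤ) : ℝ) * t) / 2 =
      -(Real.pi * (b + 1) * t) := by push_cast; ring
    rw [e1, e2, Real.sin_neg]
    linear_combination (Real.sin (Real.pi * (a + 1) * t) * Real.sin (Real.pi * (b + 1) * t)) * h2
  simp_rw [e]
  have hi : ∀ m : ℤ, Integrable (fun t : ℝ => Real.cos (Real.pi * m * t))
      (volume.restrict (Ioo (0 : ℝ) 1)) := fun m =>
    (Continuous.integrableOn_Icc (by fun_prop)).mono_set Ioo_subset_Icc_self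
  rw [integral_sub (hi _) (hi _), integral_cos_pi_int_mul, integral_cos_pi_int_mul,
    if_neg (by omega : ¬((a : ℤ) + b + 2 = 0)), sub_zero]
  congr 1
  simp [sub_eq_zero]

@[fun_prop]
theorem continuous_modeFun {n : ℕ} (k : Fin n → ℕ) : Continuous (modeFun k) := by
  unfold modeFun; fun_prop

theorem abs_modeFun_le {n : ℕ} (k : Fin n → ℕ) (x : E n) : |modeFun k x| ≤ √2 ^ n := by
  rw [modeFun, Finset.abs_prod]
  calc ∏ j, |√2 * Real.sin (Real.pi * (k j + 1) * x j)| ≤ ∏ _j : Fin n, √2 := by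
        refine Finset.prod_le_prod (fun _ _ => abs_nonneg _) fun j _ => ?_
        rw [abs_mul, abs_of_nonneg (Real.sqrt_nonneg 2)]
        exact mul_le_of_le_one_right (Real.sqrt_nonneg 2) (Real.abs_sin_le_one _)
    _ = √2 ^ n := by simp

/-- The eigenfunction `modeFun k` as a bounded continuous function. -/
def mode {n : ℕ} (k : Fin n → ℕ) : BoundedContinuousFunction (E n) ℝ :=
  BoundedContinuousFunction.ofNormedAddCommGroup (modeFun k) (continuous_modeFun k) (√2 ^ n)
    (abs_modeFun_le k)

@[simp]
theorem mode_apply {n : ℕ} (k : Fin n → ℕ) (x : E n) : mode k x = modeFun k x := rfl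

theorem norm_mode_le {n : ℕ} (k : Fin n → ℕ) : ‖mode k‖ ≤ √2 ^ n :=
  BoundedContinuousFunction.norm_ofNormedAddCommGroup_le _ (by positivity) _

/-- The map sending a bounded continuous function to its class in `L²` of the cube. -/
def toL2 (n : ℕ) : BoundedContinuousFunction (E n) ℝ →L[ℝ] L2 (cube n) :=
  BoundedContinuousFunction.toLp 2 (volume.restrict (cube n)) ℝ

theorem coeFn_toL2 {n : ℕ} (f : BoundedContinuousFunction (E n) ℝ) :
    toL2 n f =ᵐ[volume.restrict (cube n)] f :=
  BoundedContinuousFunction.coeFn_toLp 2 _ ℝ f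

theorem norm_toL2_le {n : ℕ} (f : BoundedContinuousFunction (E n) ℝ) : ‖toL2 n f‖ ≤ ‖f‖ := by
  refine (BoundedContinuousFunction.Lp_norm_le f).trans ?_
  simp [measureUnivNNReal]

theorem inner_toL2 {n : ℕ} (f : BoundedContinuousFunction (E n) ℝ) (g : L2 (cube n)) :
    ⟪toL2 n f, g⟫ = ∫ x in cube n, f x * g x := by
  rw [L2.inner_def]
  refine integral_congr_ae ?_
  filter_upwards [coeFn_toL2 f] with x hx
  rw [hx, real_inner_eq_re_inner ℝ]
  simp [mul_comm]

theorem orthonormal_mode (n : ℕ) : Orthonormal ℝ fun k : Fin n → ℕ => toL2 n (mode k) := by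
  rw [orthonormal_iff_ite]
  intro k l
  rw [inner_toL2]
  have e : ∫ x in cube n, mode k x * toL2 n (mode l) x = ∫ x in cube n, ∏ j,
      (√2 * Real.sin (Real.pi * (k j + 1) * x j)) * (√2 * Real.sin (Real.pi * (l j + 1) * x j)) := by
    refine integral_congr_ae ?_
    filter_upwards [coeFn_toL2 (mode l)] with x hx
    rw [hx, Finset.prod_mul_distrib]
    rfl
  rw [e, integral_cube_prod fun j t => (√2 * Real.sin (Real.pi * (k j + 1) * t)) *
    (√2 * Real.sin (Real.pi * (l j + 1) * t))]
  simp_rw [integral_sin_mul_sin_Ioo]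
  by_cases h : k = l
  · simp [h]
  · rw [if_neg h]
    obtain ⟨j, hj⟩ := Function.ne_iff.1 h
    exact Finset.prod_eq_zero (Finset.mem_univ j) (if_neg hj)

/-- The linear span of the eigenfunctions, as a space of continuous functions on `ℝⁿ`. -/
def modeSpan (n : ℕ) : Submodule ℝ C(E n, ℝ) :=
  Submodule.span ℝ (range fun k : Fin n → ℕ => (mode k).toContinuousMap)

/-- The algebra of continuous multipliers of the span of the eigenfunctions. It contains the
functions `cos (π xⱼ)`, because `2 cos s sin (m s) = sin ((m + 1) s) + sin ((m - 1) s)`. -/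
def modeMultiplier (n : ℕ) : Subalgebra ℝ C(E n, ℝ) where
  carrier := {G | ∀ h ∈ modeSpan n, G * h ∈ modeSpan n}
  mul_mem' {F G} hF hG h hh := by rw [mul_assoc]; exact hF _ (hG _ hh)
  add_mem' {F G} hF hG h hh := by rw [add_mul]; exact add_mem (hF _ hh) (hG _ hh)
  algebraMap_mem' r h hh := by
    rw [← Algebra.smul_def]; exact Submodule.smul_mem _ _ hh

/-- The continuous function `cos (π xⱼ)`. -/
def cosCoord (n : ℕ) (j : Fin n) : C(E n, ℝ) := ⟨fun x => Real.cos (Real.pi * x j), by fun_prop⟩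

theorem modeFun_eq_mul_prod_erase {n : ℕ} (k : Fin n → ℕ) (j : Fin n) (x : E n) :
    modeFun k x = (√2 * Real.sin (Real.pi * (k j + 1) * x j)) *
      ∏ i ∈ Finset.univ.erase j, √2 * Real.sin (Real.pi * (k i + 1) * x i) :=
  (Finset.mul_prod_erase _ _ (Finset.mem_univ j)).symm

theorem modeFun_update {n : ℕ} (k : Fin n → ℕ) (j : Fin n) (m : ℕ) (x : E n) :
    modeFun (Function.update k j m) x = (√2 * Real.sin (Real.pi * (m + 1) * x j)) *
      ∏ i ∈ Finset.univ.erase j, √2 * Real.sin (Real.pi * (k i + 1) * x i) := by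
  rw [modeFun_eq_mul_prod_erase _ j, Function.update_self]
  congr 1
  refine Finset.prod_congr rfl fun i hi => ?_
  rw [Function.update_of_ne (Finset.ne_of_mem_erase hi)]

theorem cosCoord_mem_modeMultiplier (n : ℕ) (j : Fin n) : cosCoord n j ∈ modeMultiplier n := by
  intro h hh
  induction hh using Submodule.span_induction with
  | mem h hh =>
    obtain ⟨k, rfl⟩ := hh
    have hm : ∀ l : Fin n → ℕ, (mode l).toContinuousMap ∈ modeSpan n := fun l =>
      Submodule.subset_span ⟨l, rfl⟩
    rcases Nat.eq_zero_or_pos (k j) with h0 | hpos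
    · have e : cosCoord n j * (mode k).toContinuousMap =
          (1 / 2 : ℝ) • (mode (Function.update k j (k j + 1))).toContinuousMap := by
        ext x
        have h2 : Real.sin (Real.pi * (1 + 1) * x j) =
            2 * Real.sin (Real.pi * (0 + 1) * x j) * Real.cos (Real.pi * x j) := by
          rw [show Real.pi * (1 + 1) * x j = 2 * (Real.pi * x j) by ring, Real.sin_two_mul]
          ring_nf
        change Real.cos (Real.pi * x j) * modeFun k x = 1 / 2 * modeFun (Function.update k j _) x
        rw [modeFun_update, modeFun_eq_mul_prod_erase k j, h0]
        push_cast
        rw [zero_add (1 : ℝ), h2, zero_add (1 : ℝ)]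
        ring
      rw [e]
      exact Submodule.smul_mem _ _ (hm _)
    · obtain ⟨m, hm'⟩ : ∃ m, k j = m + 1 := ⟨k j - 1, by omega⟩
      have e : cosCoord n j * (mode k).toContinuousMap =
          (1 / 2 : ℝ) • ((mode (Function.update k j (m + 2))).toContinuousMap +
            (mode (Function.update k j m)).toContinuousMap) := by
        ext x
        have h2 : Real.sin (Real.pi * (m + 2 + 1) * x j) + Real.sin (Real.pi * (m + 1) * x j) =
            2 * Real.sin (Real.pi * (m + 1 + 1) * x j) * Real.cos (Real.pi * x j) := by
          rw [show Real.pi * (m + 2 + 1) * x j = Real.pi * (m + 1 + 1) * x j + Real.pi * x j by ring,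
            show Real.pi * (m + 1) * x j = Real.pi * (m + 1 + 1) * x j - Real.pi * x j by ring,
            Real.sin_add, Real.sin_sub]
          ring
        change Real.cos (Real.pi * x j) * modeFun k x =
          1 / 2 * (modeFun (Function.update k j _) x + modeFun (Function.update k j _) x)
        rw [modeFun_update, modeFun_update, modeFun_eq_mul_prod_erase k j, hm']
        push_cast
        linear_combination (-(1 / 2) * √2 *
          ∏ i ∈ Finset.univ.erase j, √2 * Real.sin (Real.pi * (k i + 1) * x i)) * h2
      rw [e]
      exact Submodule.smul_mem _ _ (add_mem (hm _) (hm _))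
  | zero => rw [mul_zero]; exact zero_mem _
  | add a b _ _ ha hb => rw [mul_add]; exact add_mem ha hb
  | smul c a _ ha => rw [mul_smul_comm]; exact Submodule.smul_mem _ _ ha

/-- The closed unit cube. -/
def closedCube (n : ℕ) : Set (E n) := {x | ∀ j, x j ∈ Icc (0 : ℝ) 1}

theorem isCompact_closedCube (n : ℕ) : IsCompact (closedCube n) := by
  have h : closedCube n = (PiLp.homeomorph 2 fun _ : Fin n => ℝ) ⁻¹'
      (univ.pi fun _ => Icc (0 : ℝ) 1) := by
    ext x; simp only [closedCube, mem_preimage, mem_univ_pi, mem_ofPred_eq]; rfl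
  rw [h, Homeomorph.isCompact_preimage]
  exact isCompact_univ_pi fun _ => isCompact_Icc

theorem cube_subset_closedCube (n : ℕ) : cube n ⊆ closedCube n :=
  fun _ hx j => Ioo_subset_Icc_self (hx j)

/-- Stone–Weierstrass: `x ↦ (cos (π xⱼ))ⱼ` is injective on the closed cube. -/
theorem exists_modeMultiplier_near {n : ℕ} (ψ : C(E n, ℝ)) {ε : ℝ} (hε : 0 < ε) :
    ∃ G ∈ modeMultiplier n, ∀ x ∈ cube n, |G x - ψ x| < ε := by
  have := isCompact_iff_compactSpace.1 (isCompact_closedCube n)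
  let r : C(E n, ℝ) →ₐ[ℝ] C(closedCube n, ℝ) :=
    ContinuousMap.compRightAlgHom ℝ ℝ ⟨Subtype.val, continuous_subtype_val⟩
  have hsep : ((modeMultiplier n).map r).SeparatesPoints := by
    intro x y hxy
    obtain ⟨j, hj⟩ : ∃ j, x.1 j ≠ y.1 j := by
      by_contra! h
      exact hxy (Subtype.ext (PiLp.ext h))
    refine ⟨_, ⟨r (cosCoord n j), ⟨_, cosCoord_mem_modeMultiplier n j, rfl⟩, rfl⟩, fun h => hj ?_⟩
    have hmem : ∀ z : closedCube n, Real.pi * z.1 j ∈ Icc 0 Real.pi := fun z =>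
      ⟨mul_nonneg Real.pi_pos.le (z.2 j).1, mul_le_of_le_one_right Real.pi_pos.le (z.2 j).2⟩
    exact mul_left_cancel₀ Real.pi_ne_zero (Real.injOn_cos (hmem x) (hmem y) h)
  obtain ⟨⟨g, G, hG, rfl⟩, hg⟩ :=
    ContinuousMap.exists_mem_subalgebra_near_continuousMap_of_separatesPoints _ hsep (r ψ) ε hε
  refine ⟨G, hG, fun x hx => ?_⟩
  exact (ContinuousMap.norm_coe_le_norm (r G - r ψ) ⟨x, cube_subset_closedCube n hx⟩).trans_lt hg

theorem modeFun_zero_pos {n : ℕ} {x : E n} (hx : x ∈ cube n) : 0 < modeFun 0 x := by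
  refine Finset.prod_pos fun j _ => mul_pos (by positivity) (Real.sin_pos_of_pos_of_lt_pi ?_ ?_)
  · have := (hx j).1
    simp only [Pi.zero_apply, Nat.cast_zero]
    have := Real.pi_pos
    positivity
  · have := (hx j).2
    simp only [Pi.zero_apply, Nat.cast_zero]
    have := Real.pi_pos
    nlinarith

theorem L2_integrable {n : ℕ} (f : L2 (cube n)) : Integrable f (volume.restrict (cube n)) :=
  (Lp.memLp f).integrable (by norm_num)

/-- A function orthogonal to all sine products vanishes: its product with the first, positive,
eigenfunction is orthogonal to the multiplier algebra, hence to every continuous function. -/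
theorem eq_zero_of_inner_mode_eq_zero {n : ℕ} (f : L2 (cube n))
    (hf : ∀ k, ⟪toL2 n (mode k), f⟫ = 0) : f = 0 := by
  set μ := volume.restrict (cube n) with hμ
  have hfi : Integrable f μ := L2_integrable f
  have hbd : ∀ g : E n → ℝ, Continuous g → ∀ C : ℝ, (∀ x ∈ cube n, |g x| ≤ C) →
      Integrable (fun x => g x * f x) μ := fun g hg C hC =>
    hfi.bdd_mul hg.aestronglyMeasurable
      ((ae_restrict_iff' (measurableSet_cube n)).2 (.of_forall hC))
  have hcont : ∀ g : C(E n, ℝ), Integrable (fun x => g x * f x) μ := by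
    intro g
    obtain ⟨C, hC⟩ := (isCompact_closedCube n).exists_bound_of_continuousOn
      (f := g) g.continuous.continuousOn
    exact hbd g g.continuous C fun x hx => hC x (cube_subset_closedCube n hx)
  have hspan : ∀ h ∈ modeSpan n, ∫ x, h x * f x ∂μ = 0 := by
    intro h hh
    induction hh using Submodule.span_induction with
    | mem h hh =>
      obtain ⟨k, rfl⟩ := hh
      exact (inner_toL2 (mode k) f).symm.trans (hf k)
    | zero => simp
    | add a b _ _ ha hb =>
      simp only [ContinuousMap.add_apply, add_mul]
      rw [integral_add (hcont a) (hcont b), ha, hb, add_zero]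
    | smul c a _ ha =>
      simp only [ContinuousMap.smul_apply, smul_eq_mul, mul_assoc]
      rw [integral_const_mul, ha, mul_zero]
  have hm0 : Integrable (fun x => modeFun 0 x * f x) μ :=
    hbd _ (continuous_modeFun 0) _ fun x _ => abs_modeFun_le 0 x
  have hψ : ∀ ψ : C(E n, ℝ), ∫ x, ψ x * (modeFun 0 x * f x) ∂μ = 0 := by
    intro ψ
    set I := ∫ x, |modeFun 0 x * f x| ∂μ with hI
    have hI0 : 0 ≤ I := integral_nonneg fun _ => abs_nonneg _
    have hint : ∀ g : C(E n, ℝ), Integrable (fun x => g x * (modeFun 0 x * f x)) μ := by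
      intro g
      have := hcont (g * (mode 0).toContinuousMap)
      refine this.congr (.of_forall fun x => ?_)
      exact mul_assoc _ _ _
    have hle : ∀ ε > 0, |∫ x, ψ x * (modeFun 0 x * f x) ∂μ| ≤ ε * I := by
      intro ε hε
      obtain ⟨G, hG, hGψ⟩ := exists_modeMultiplier_near ψ hε
      have h0 : ∫ x, G x * (modeFun 0 x * f x) ∂μ = 0 := by
        rw [← hspan _ (hG _ (Submodule.subset_span ⟨0, rfl⟩))]
        exact integral_congr_ae (.of_forall fun x => (mul_assoc _ _ _).symm)
      have h1 : ∫ x, ψ x * (modeFun 0 x * f x) ∂μ =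
          ∫ x, (ψ x - G x) * (modeFun 0 x * f x) ∂μ := by
        simp only [sub_mul]
        rw [integral_sub (hint ψ) (hint G), h0, sub_zero]
      rw [h1, hI, ← integral_const_mul]
      have hb : ∀ᵐ x ∂μ, ‖(ψ x - G x) * (modeFun 0 x * f x)‖ ≤ ε * |modeFun 0 x * f x| := by
        filter_upwards [ae_restrict_mem (measurableSet_cube n)] with x hx
        rw [norm_mul, Real.norm_eq_abs, Real.norm_eq_abs, abs_sub_comm]
        exact mul_le_mul_of_nonneg_right (hGψ x hx).le (abs_nonneg _)
      exact norm_integral_le_of_norm_le (hm0.abs.const_mul ε) hb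
    refine abs_nonpos_iff.1 (le_of_forall_pos_le_add fun δ hδ => ?_)
    refine (hle (δ / (I + 1)) (by positivity)).trans ?_
    rw [zero_add, div_mul_eq_mul_div, div_le_iff₀ (by positivity)]
    nlinarith
  have hae : ∀ᵐ x ∂μ, modeFun 0 x * f x = 0 := by
    refine ae_eq_zero_of_integral_contDiff_smul_eq_zero (F := ℝ) hm0.locallyIntegrable
      fun g hg _ => ?_
    exact hψ ⟨g, hg.continuous⟩
  refine Lp.ext ?_
  filter_upwards [hae, Lp.coeFn_zero ℝ 2 μ, ae_restrict_mem (measurableSet_cube n)] with x hx h0 hxc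
  rw [h0]
  exact (mul_eq_zero.1 hx).resolve_left (modeFun_zero_pos hxc).ne'

/-- The orthonormal basis of `L²` of the cube formed by the sine products. -/
def modeBasis (n : ℕ) : HilbertBasis (Fin n → ℕ) ℝ (L2 (cube n)) :=
  HilbertBasis.mkOfOrthogonalEqBot (orthonormal_mode n) (by
    rw [Submodule.eq_bot_iff]
    intro f hf
    refine eq_zero_of_inner_mode_eq_zero f fun k => ?_
    exact (Submodule.mem_orthogonal _ _).1 hf _ (Submodule.subset_span ⟨k, rfl⟩))

@[simp]
theorem modeBasis_apply {n : ℕ} (k : Fin n → ℕ) : modeBasis n k = toL2 n (mode k) := by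
  simp [modeBasis]

/-! ### Smooth cutoffs of the one-dimensional eigenfunctions -/

/-- The one-dimensional Dirichlet eigenfunction `√2 sin (π (m + 1) t)`. -/
def sinMode (m : ℕ) (t : ℝ) : ℝ := √2 * Real.sin (Real.pi * (m + 1) * t)

theorem contDiff_sinMode (m : ℕ) : ContDiff ℝ ∞ (sinMode m) := by
  unfold sinMode; fun_prop

theorem deriv_sinMode (m : ℕ) :
    deriv (sinMode m) = fun t => √2 * (Real.pi * (m + 1)) * Real.cos (Real.pi * (m + 1) * t) := by
  funext t
  have h : HasDerivAt (fun t : ℝ => Real.pi * (m + 1) * t) (Real.pi * (m + 1)) t := by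
    simpa using (hasDerivAt_id t).const_mul (Real.pi * (m + 1))
  rw [show sinMode m = fun t => √2 * Real.sin (Real.pi * (m + 1) * t) from rfl,
    (h.sin.const_mul √2).deriv]
  ring

theorem deriv_deriv_sinMode (m : ℕ) :
    deriv (deriv (sinMode m)) = fun t => -(Real.pi * (m + 1)) ^ 2 * sinMode m t := by
  funext t
  have h : HasDerivAt (fun t : ℝ => Real.pi * (m + 1) * t) (Real.pi * (m + 1)) t := by
    simpa using (hasDerivAt_id t).const_mul (Real.pi * (m + 1))
  rw [deriv_sinMode, (h.cos.const_mul (√2 * (Real.pi * (m + 1)))).deriv, sinMode]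
  ring

theorem abs_sinMode_le (m : ℕ) (t : ℝ) : |sinMode m t| ≤ √2 := by
  rw [sinMode, abs_mul, abs_of_nonneg (Real.sqrt_nonneg 2)]
  exact mul_le_of_le_one_right (Real.sqrt_nonneg 2) (Real.abs_sin_le_one _)

theorem abs_deriv_sinMode_le (m : ℕ) (t : ℝ) : |deriv (sinMode m) t| ≤ √2 * (Real.pi * (m + 1)) := by
  rw [deriv_sinMode, abs_mul, abs_of_nonneg (by positivity)]
  exact mul_le_of_le_one_right (by positivity) (Real.abs_cos_le_one _)

theorem abs_sinMode_le_mul_abs (m : ℕ) (t : ℝ) :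
    |sinMode m t| ≤ √2 * (Real.pi * (m + 1)) * |t| := by
  rw [sinMode, abs_mul, abs_of_nonneg (Real.sqrt_nonneg 2), mul_assoc √2]
  refine mul_le_mul_of_nonneg_left (Real.abs_sin_le_abs.trans ?_) (Real.sqrt_nonneg 2)
  rw [abs_mul, abs_of_nonneg (by positivity : (0 : ℝ) ≤ Real.pi * (m + 1))]

theorem abs_sinMode_one_sub (m : ℕ) (t : ℝ) : |sinMode m (1 - t)| = |sinMode m t| := by
  have h : Real.pi * (m + 1) * (1 - t) = ((m + 1 : ℕ) : ℝ) * Real.pi - Real.pi * (m + 1) * t := by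
    push_cast; ring
  rw [sinMode, sinMode, h, Real.sin_sub, Real.sin_nat_mul_pi, zero_mul, zero_sub, mul_neg, abs_neg,
    abs_mul, abs_mul, abs_mul, Real.cos_nat_mul_pi, abs_pow, abs_neg, abs_one, one_pow, one_mul]

theorem deriv_smoothTransition_eq_zero {t : ℝ} (ht : t < 0 ∨ 1 < t) :
    deriv Real.smoothTransition t = 0 := by
  rcases ht with h | h
  · have e : Real.smoothTransition =ᶠ[𝓝 t] fun _ => 0 := by
      filter_upwards [Iio_mem_nhds h] with s hs using Real.smoothTransition.zero_of_nonpos hs.le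
    rw [e.deriv_eq, deriv_const]
  · have e : Real.smoothTransition =ᶠ[𝓝 t] fun _ => 1 := by
      filter_upwards [Ioi_mem_nhds h] with s hs using Real.smoothTransition.one_of_one_le hs.le
    rw [e.deriv_eq, deriv_const]

theorem exists_abs_deriv_smoothTransition_le :
    ∃ D : ℝ, 0 ≤ D ∧ ∀ t, |deriv Real.smoothTransition t| ≤ D := by
  have hc : Continuous (deriv Real.smoothTransition) :=
    (Real.smoothTransition.contDiff (n := 1)).continuous_deriv le_rfl
  obtain ⟨D, hD⟩ := isCompact_Icc.exists_bound_of_continuousOn (s := Icc (0 : ℝ) 1) hc.continuousOn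
  have hD0 : 0 ≤ D := (norm_nonneg _).trans (hD 0 (by simp))
  refine ⟨D, hD0, fun t => ?_⟩
  by_cases ht : t ∈ Icc (0 : ℝ) 1
  · exact hD t ht
  · rw [deriv_smoothTransition_eq_zero, abs_zero]
    · exact hD0
    · simp only [mem_Icc, not_and_or, not_le] at ht
      exact ht

/-- The product of `sinMode m` with a smooth cutoff which vanishes at distance at most `1 / N` from
the boundary of `(0, 1)` and is `1` at distance at least `2 / N`. -/
def cutSin (m N : ℕ) (t : ℝ) : ℝ :=
  sinMode m t * (Real.smoothTransition (N * t - 1) * Real.smoothTransition (N * (1 - t) - 1))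

theorem contDiff_cutSin (m N : ℕ) : ContDiff ℝ ∞ (cutSin m N) := by
  unfold cutSin
  have := contDiff_sinMode m
  have h : ContDiff ℝ ∞ Real.smoothTransition := Real.smoothTransition.contDiff
  fun_prop

theorem cutSin_eq_zero {m N : ℕ} {t : ℝ} (ht : t ∉ Icc (1 / ((N : ℝ) + 1)) (1 - 1 / (N + 1))) :
    cutSin m (N + 1) t = 0 := by
  have hN : (0 : ℝ) < N + 1 := by positivity
  simp only [mem_Icc, not_and_or, not_le] at ht
  rw [cutSin]
  push_cast
  rcases ht with h | h
  · rw [lt_div_iff₀ hN] at h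
    rw [Real.smoothTransition.zero_of_nonpos (x := (N + 1) * t - 1) (by linarith)]
    ring
  · have h : 1 - t < 1 / (N + 1) := by linarith
    rw [lt_div_iff₀ hN] at h
    rw [Real.smoothTransition.zero_of_nonpos (x := (N + 1) * (1 - t) - 1) (by linarith)]
    ring

theorem abs_smoothTransition_le_one (t : ℝ) : |Real.smoothTransition t| ≤ 1 := by
  rw [abs_of_nonneg (Real.smoothTransition.nonneg t)]
  exact Real.smoothTransition.le_one t

theorem abs_cutSin_le (m N : ℕ) (t : ℝ) : |cutSin m N t| ≤ √2 := by
  rw [cutSin, abs_mul, abs_mul, ← mul_one √2]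
  refine mul_le_mul (abs_sinMode_le m t) ?_ (by positivity) (Real.sqrt_nonneg 2)
  exact mul_le_one₀ (abs_smoothTransition_le_one _) (abs_nonneg _) (abs_smoothTransition_le_one _)

theorem hasDerivAt_cutSin (m N : ℕ) (t : ℝ) : HasDerivAt (cutSin m N)
    (deriv (sinMode m) t *
      (Real.smoothTransition (N * t - 1) * Real.smoothTransition (N * (1 - t) - 1)) +
     sinMode m t * (deriv Real.smoothTransition (N * t - 1) * N *
        Real.smoothTransition (N * (1 - t) - 1) + Real.smoothTransition (N * t - 1) *
        (deriv Real.smoothTransition (N * (1 - t) - 1) * (N * -1)))) t := by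
  have hS : ∀ s, HasDerivAt Real.smoothTransition (deriv Real.smoothTransition s) s := fun s =>
    ((Real.smoothTransition.contDiff (n := 1)).differentiable one_ne_zero s).hasDerivAt
  have h0 : HasDerivAt (sinMode m) (deriv (sinMode m) t) t :=
    ((contDiff_sinMode m).differentiable (by simp) t).hasDerivAt
  have h1 : HasDerivAt (fun t : ℝ => (N : ℝ) * t - 1) N t := by
    simpa using ((hasDerivAt_id t).const_mul (N : ℝ)).sub_const 1
  have h2 : HasDerivAt (fun t : ℝ => (N : ℝ) * (1 - t) - 1) (N * -1) t := by
    simpa using (((hasDerivAt_id t).const_sub 1).const_mul (N : ℝ)).sub_const 1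
  exact h0.mul (((hS _).comp t h1).mul ((hS _).comp t h2))

/-- The derivative of the cutoff is `O(N)`, but it is supported where `sinMode m` is `O(1 / N)`. -/
theorem exists_abs_deriv_cutSin_le (m : ℕ) : ∃ C : ℝ, ∀ N t, |deriv (cutSin m N) t| ≤ C := by
  obtain ⟨D, hD0, hD⟩ := exists_abs_deriv_smoothTransition_le
  have key : ∀ (N : ℕ) (t : ℝ), N * |t| * |deriv Real.smoothTransition (N * t - 1)| ≤ 2 * D := by
    intro N t
    by_cases h : (N : ℝ) * t - 1 < 0 ∨ 1 < (N : ℝ) * t - 1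
    · rw [deriv_smoothTransition_eq_zero h]; simp [hD0]
    · simp only [not_or, not_lt] at h
      have h1 : (N : ℝ) * |t| ≤ 2 := by
        rw [← abs_of_nonneg (Nat.cast_nonneg (α := ℝ) N), ← abs_mul, abs_of_nonneg (by linarith)]
        linarith
      exact mul_le_mul h1 (hD _) (abs_nonneg _) (by norm_num)
  set A := √2 * (Real.pi * (m + 1)) with hA
  have hA0 : 0 ≤ A := by positivity
  refine ⟨A + (A * (2 * D) + A * (2 * D)), fun N t => ?_⟩
  rw [(hasDerivAt_cutSin m N t).deriv]
  have hT := abs_smoothTransition_le_one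
  refine (abs_add_le _ _).trans (add_le_add ?_ ?_)
  · rw [abs_mul, abs_mul, ← mul_one A]
    refine mul_le_mul (abs_deriv_sinMode_le m t) ?_ (by positivity) hA0
    exact mul_le_one₀ (hT _) (abs_nonneg _) (hT _)
  · rw [mul_add]
    refine (abs_add_le _ _).trans (add_le_add ?_ ?_)
    · rw [abs_mul, abs_mul, abs_mul, Nat.abs_cast]
      have h1 := abs_sinMode_le_mul_abs m t
      calc |sinMode m t| * (|deriv Real.smoothTransition (N * t - 1)| * N *
            |Real.smoothTransition (N * (1 - t) - 1)|)
          ≤ (A * |t|) * (|deriv Real.smoothTransition (N * t - 1)| * N * 1) := by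
            gcongr
            exact hT _
        _ = A * (N * |t| * |deriv Real.smoothTransition (N * t - 1)|) := by ring
        _ ≤ A * (2 * D) := by exact mul_le_mul_of_nonneg_left (key N t) hA0
    · rw [abs_mul, abs_mul, abs_mul, abs_mul, abs_neg, abs_one, Nat.abs_cast]
      have h1 := abs_sinMode_le_mul_abs m (1 - t)
      rw [abs_sinMode_one_sub] at h1
      calc |sinMode m t| * (|Real.smoothTransition (N * t - 1)| *
            (|deriv Real.smoothTransition (N * (1 - t) - 1)| * (N * 1)))
          ≤ (A * |1 - t|) * (1 * (|deriv Real.smoothTransition (N * (1 - t) - 1)| * (N * 1))) := by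
            gcongr
            exact hT _
        _ = A * (N * |1 - t| * |deriv Real.smoothTransition (N * (1 - t) - 1)|) := by ring
        _ ≤ A * (2 * D) := by exact mul_le_mul_of_nonneg_left (key N (1 - t)) hA0

theorem eventually_cutSin_eq (m : ℕ) {t : ℝ} (ht : t ∈ Ioo (0 : ℝ) 1) :
    ∀ᶠ N : ℕ in Filter.atTop, cutSin m N =ᶠ[𝓝 t] sinMode m := by
  have h1 : ∀ᶠ N : ℕ in Filter.atTop, 2 < (N : ℝ) * t :=
    (tendsto_natCast_atTop_atTop.atTop_mul_const ht.1).eventually_gt_atTop 2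
  have h2 : ∀ᶠ N : ℕ in Filter.atTop, 2 < (N : ℝ) * (1 - t) :=
    (tendsto_natCast_atTop_atTop.atTop_mul_const (sub_pos.2 ht.2)).eventually_gt_atTop 2
  filter_upwards [h1, h2] with N hN1 hN2
  have c1 : ∀ᶠ s in 𝓝 t, 2 < (N : ℝ) * s :=
    (by fun_prop : ContinuousAt (fun s : ℝ => (N : ℝ) * s) t).eventually_const_lt hN1
  have c2 : ∀ᶠ s in 𝓝 t, 2 < (N : ℝ) * (1 - s) :=
    (by fun_prop : ContinuousAt (fun s : ℝ => (N : ℝ) * (1 - s)) t).eventually_const_lt hN2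
  filter_upwards [c1, c2] with s h1 h2
  rw [cutSin, Real.smoothTransition.one_of_one_le (by linarith),
    Real.smoothTransition.one_of_one_le (by linarith), mul_one, mul_one]

/-! ### Products of functions of one variable and their gradients -/

/-- The function `x ↦ ∏ⱼ gⱼ(xⱼ)`. -/
def prodFun {n : ℕ} (g : Fin n → ℝ → ℝ) (x : E n) : ℝ := ∏ j, g j (x j)

/-- The factors of the partial derivative `∂ᵢ ∏ⱼ gⱼ(xⱼ)`. -/
def partialFactors {n : ℕ} (g : Fin n → ℝ → ℝ) (i : Fin n) : Fin n → ℝ → ℝ :=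
  Function.update g i (deriv (g i))

theorem prodFun_update {n : ℕ} (g : Fin n → ℝ → ℝ) (i : Fin n) (h : ℝ → ℝ) (x : E n) :
    prodFun (Function.update g i h) x = (∏ j ∈ Finset.univ.erase i, g j (x j)) * h (x i) := by
  rw [prodFun, ← Finset.prod_erase_mul _ _ (Finset.mem_univ i), Function.update_self]
  congr 1
  refine Finset.prod_congr rfl fun j hj => ?_
  rw [Function.update_of_ne (Finset.ne_of_mem_erase hj)]

theorem contDiff_prodFun {n : ℕ} {g : Fin n → ℝ → ℝ} (hg : ∀ j, ContDiff ℝ ∞ (g j)) :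
    ContDiff ℝ ∞ (prodFun g) :=
  contDiff_prod fun j _ => (hg j).comp (EuclideanSpace.proj (𝕜 := ℝ) j).contDiff

theorem contDiff_partialFactors {n : ℕ} {g : Fin n → ℝ → ℝ} (hg : ∀ j, ContDiff ℝ ∞ (g j))
    (i j : Fin n) : ContDiff ℝ ∞ (partialFactors g i j) := by
  rcases eq_or_ne j i with rfl | h
  · rw [partialFactors, Function.update_self]
    exact (contDiff_infty_iff_deriv.1 (hg j)).2
  · rw [partialFactors, Function.update_of_ne h]
    exact hg j

theorem fderiv_prodFun_single {n : ℕ} {g : Fin n → ℝ → ℝ} (hg : ∀ j, ContDiff ℝ ∞ (g j))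
    (x : E n) (i : Fin n) :
    fderiv ℝ (prodFun g) x (EuclideanSpace.single i 1) = prodFun (partialFactors g i) x := by
  have h : ∀ j ∈ Finset.univ, HasFDerivAt (fun x : E n => g j (x j))
      (deriv (g j) (x j) • (EuclideanSpace.proj j : E n →L[ℝ] ℝ)) x := fun j _ => by
    have h1 : HasDerivAt (g j) (deriv (g j) (x j)) (x j) :=
      ((hg j).differentiable (by simp) _).hasDerivAt
    exact h1.comp_hasFDerivAt x (EuclideanSpace.proj j : E n →L[ℝ] ℝ).hasFDerivAt
  have h2 := (HasFDerivAt.finsetProd h).fderiv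
  rw [show prodFun g = fun x : E n => ∏ j, g j (x j) from rfl, h2, partialFactors, prodFun_update,
    _root_.sum_apply, Finset.sum_eq_single i]
  · simp
  · intro j _ hj
    simp [hj]
  · simp

theorem gradient_prodFun {n : ℕ} {g : Fin n → ℝ → ℝ} (hg : ∀ j, ContDiff ℝ ∞ (g j)) (x : E n) :
    gradient (prodFun g) x =
      ∑ i, prodFun (partialFactors g i) x • (EuclideanSpace.single i 1 : E n) := by
  rw [← (EuclideanSpace.basisFun (Fin n) ℝ).sum_repr' (gradient (prodFun g) x)]
  refine Finset.sum_congr rfl fun i _ => ?_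
  rw [real_inner_comm, inner_gradient_left, EuclideanSpace.basisFun_apply, fderiv_prodFun_single hg]

theorem abs_prodFun_le {n : ℕ} {g : Fin n → ℝ → ℝ} {C : ℝ} (hC : ∀ j t, |g j t| ≤ C) (x : E n) :
    |prodFun g x| ≤ C ^ n := by
  rw [prodFun, Finset.abs_prod]
  calc ∏ j, |g j (x j)| ≤ ∏ _j : Fin n, C :=
        Finset.prod_le_prod (fun _ _ => abs_nonneg _) fun j _ => hC j _
    _ = C ^ n := by simp

theorem abs_partialFactors_le {n : ℕ} {g : Fin n → ℝ → ℝ} {C : ℝ} (hC : ∀ j t, |g j t| ≤ C)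
    (hC' : ∀ j t, |deriv (g j) t| ≤ C) (i j : Fin n) (t : ℝ) : |partialFactors g i j t| ≤ C := by
  rcases eq_or_ne j i with rfl | h
  · rw [partialFactors, Function.update_self]; exact hC' j t
  · rw [partialFactors, Function.update_of_ne h]; exact hC j t

theorem norm_gradient_prodFun_le {n : ℕ} {g : Fin n → ℝ → ℝ} (hg : ∀ j, ContDiff ℝ ∞ (g j)) {C : ℝ}
    (hC : ∀ j t, |g j t| ≤ C) (hC' : ∀ j t, |deriv (g j) t| ≤ C) (x : E n) :
    ‖gradient (prodFun g) x‖ ≤ n * C ^ n := by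
  rw [gradient_prodFun hg]
  refine (norm_sum_le _ _).trans ?_
  calc ∑ i, ‖prodFun (partialFactors g i) x • (EuclideanSpace.single i 1 : E n)‖
      ≤ ∑ _i : Fin n, C ^ n := by
        refine Finset.sum_le_sum fun i _ => ?_
        rw [norm_smul, PiLp.norm_single, norm_one, mul_one]
        exact abs_prodFun_le (abs_partialFactors_le hC hC' i) x
    _ = n * C ^ n := by simp

theorem continuous_gradient {n : ℕ} {ψ : E n → ℝ} (hψ : ContDiff ℝ ∞ ψ) : Continuous (gradient ψ) := by
  have : gradient ψ = fun x => (InnerProductSpace.toDual ℝ (E n)).symm (fderiv ℝ ψ x) := rfl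
  rw [this]
  exact (InnerProductSpace.toDual ℝ (E n)).symm.continuous.comp (hψ.continuous_fderiv (by simp))

/-! ### The eigenfunctions belong to `H¹₀` -/

theorem tendsto_Lp_of_bounded {X V : Type*} [MeasurableSpace X] [NormedAddCommGroup V]
    {μ : Measure X} [IsFiniteMeasure μ] {f : ℕ → Lp V 2 μ} {g : Lp V 2 μ} (C : ℝ)
    (hb : ∀ N, ∀ᵐ x ∂μ, ‖f N x‖ ≤ C)
    (hl : ∀ᵐ x ∂μ, Filter.Tendsto (fun N => f N x) Filter.atTop (𝓝 (g x))) :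
    Filter.Tendsto f Filter.atTop (𝓝 g) := by
  rw [Lp.tendsto_Lp_iff_tendsto_eLpNorm']
  have hb' : ∀ᵐ x ∂μ, ∀ N, ‖f N x‖ ≤ C := ae_all_iff.2 hb
  have h1 : Filter.Tendsto (fun N => ∫⁻ x, ‖(f N - g : X → V) x‖ₑ ^ (2 : ℝ) ∂μ) Filter.atTop
      (𝓝 (∫⁻ _x, 0 ∂μ)) := by
    refine tendsto_lintegral_of_dominated_convergence' (fun _ => ENNReal.ofReal (2 * C) ^ (2 : ℝ))
      (fun N => ?_) (fun N => ?_) ?_ ?_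
    · exact (((Lp.aestronglyMeasurable (f N)).sub (Lp.aestronglyMeasurable g)).enorm).pow_const _
    · filter_upwards [hb', hl] with x hx hlx
      refine ENNReal.rpow_le_rpow ?_ (by norm_num)
      rw [← ofReal_norm]
      refine ENNReal.ofReal_le_ofReal ?_
      have hg : ‖g x‖ ≤ C := le_of_tendsto' hlx.norm hx
      exact (norm_sub_le _ _).trans (by linarith [hx N])
    · rw [lintegral_const]
      exact ENNReal.mul_ne_top (ENNReal.rpow_ne_top_of_nonneg (by norm_num) ENNReal.ofReal_ne_top)
        (measure_ne_top _ _)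
    · filter_upwards [hl] with x hx
      have h2 : Filter.Tendsto (fun N => ‖f N x - g x‖ₑ) Filter.atTop (𝓝 0) := by
        have := (hx.sub_const (g x)).enorm
        simpa using this
      have h3 := (ENNReal.continuous_rpow_const (y := 2)).continuousAt.tendsto.comp h2
      rw [ENNReal.zero_rpow_of_pos (by norm_num)] at h3
      exact h3
  simp only [lintegral_zero] at h1
  have h3 := (ENNReal.continuous_rpow_const (y := 1 / 2)).continuousAt.tendsto.comp h1
  rw [ENNReal.zero_rpow_of_pos (by norm_num)] at h3
  refine h3.congr fun N => ?_
  rw [eLpNorm_eq_lintegral_rpow_enorm_toReal (by norm_num) (by norm_num)]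
  simp

theorem isTest_prodFun {n : ℕ} {g : Fin n → ℝ → ℝ} (hg : ∀ j, ContDiff ℝ ∞ (g j)) {δ : ℝ}
    (hδ : 0 < δ) (h0 : ∀ j, ∀ t ∉ Icc δ (1 - δ), g j t = 0) : IsTest (cube n) (prodFun g) := by
  set K : Set (E n) := {x | ∀ j, x j ∈ Icc δ (1 - δ)} with hK
  have hKc : IsCompact K := by
    have h : K = (PiLp.homeomorph 2 fun _ : Fin n => ℝ) ⁻¹'
        (univ.pi fun _ => Icc δ (1 - δ)) := by
      ext x; simp only [hK, mem_preimage, mem_univ_pi, mem_ofPred_eq]; rfl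
    rw [h, Homeomorph.isCompact_preimage]
    exact isCompact_univ_pi fun _ => isCompact_Icc
  have hz : ∀ x ∉ K, prodFun g x = 0 := by
    intro x hx
    simp only [hK, mem_ofPred_eq, not_forall] at hx
    obtain ⟨j, hj⟩ := hx
    exact Finset.prod_eq_zero (Finset.mem_univ j) (h0 j _ hj)
  have hsub : tsupport (prodFun g) ⊆ K :=
    closure_minimal (fun x hx => by_contra fun h => hx (hz x h)) hKc.isClosed
  refine ⟨contDiff_prodFun hg, HasCompactSupport.intro hKc hz, hsub.trans fun x hx j => ?_⟩
  exact ⟨hδ.trans_le (hx j).1, (hx j).2.trans_lt (by linarith)⟩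

theorem memLp_gradient_of_bound {n : ℕ} {ψ : E n → ℝ} (hψ : ContDiff ℝ ∞ ψ) {C : ℝ}
    (hC : ∀ x, ‖gradient ψ x‖ ≤ C) : MemLp (gradient ψ) 2 (volume.restrict (cube n)) :=
  MemLp.of_bound (continuous_gradient hψ).aestronglyMeasurable C (.of_forall hC)

theorem memLp_of_bound {n : ℕ} {ψ : E n → ℝ} (hψ : Continuous ψ) {C : ℝ}
    (hC : ∀ x, |ψ x| ≤ C) : MemLp ψ 2 (volume.restrict (cube n)) :=
  MemLp.of_bound hψ.aestronglyMeasurable C (.of_forall hC)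

theorem contDiff_modeFun {n : ℕ} (k : Fin n → ℕ) : ContDiff ℝ ∞ (modeFun k) :=
  contDiff_prodFun (g := fun j => sinMode (k j)) fun j => contDiff_sinMode (k j)

theorem exists_norm_gradient_modeFun_le {n : ℕ} (k : Fin n → ℕ) :
    ∃ C, ∀ x, ‖gradient (modeFun k) x‖ ≤ C := by
  set C := √2 + ∑ j, √2 * (Real.pi * (k j + 1)) with hC
  refine ⟨n * C ^ n, norm_gradient_prodFun_le (g := fun j => sinMode (k j))
    (fun j => contDiff_sinMode (k j)) (fun j t => ?_) fun j t => ?_⟩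
  · refine (abs_sinMode_le _ t).trans (le_add_of_nonneg_right ?_)
    positivity
  · refine (abs_deriv_sinMode_le _ t).trans ?_
    have := Finset.single_le_sum (f := fun j : Fin n => √2 * (Real.pi * ((k j : ℝ) + 1)))
      (fun j _ => by positivity) (Finset.mem_univ j)
    refine this.trans (le_add_of_nonneg_left (by positivity))

theorem memLp_gradient_modeFun {n : ℕ} (k : Fin n → ℕ) :
    MemLp (gradient (modeFun k)) 2 (volume.restrict (cube n)) :=
  memLp_gradient_of_bound (contDiff_modeFun k) (exists_norm_gradient_modeFun_le k).choose_spec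

/-- The eigenfunction `modeFun k` together with its gradient. -/
def modePair {n : ℕ} (k : Fin n → ℕ) : Pair (cube n) :=
  WithLp.toLp 2 (toL2 n (mode k), (memLp_gradient_modeFun k).toLp _)

/-- The products of the one-dimensional cutoffs are test functions which converge in `H¹`. -/
theorem modePair_mem_H10 {n : ℕ} (k : Fin n → ℕ) : modePair k ∈ H10 (cube n) := by
  set g : ℕ → Fin n → ℝ → ℝ := fun N j => cutSin (k j) (N + 1) with hg
  have hgs : ∀ N j, ContDiff ℝ ∞ (g N j) := fun N j => contDiff_cutSin _ _
  choose D hD using fun j : Fin n => exists_abs_deriv_cutSin_le (k j)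
  set C := √2 + ∑ j, |D j| with hC
  have hC1 : ∀ N j t, |g N j t| ≤ C := fun N j t =>
    (abs_cutSin_le _ _ t).trans (le_add_of_nonneg_right (by positivity))
  have hC2 : ∀ N j t, |deriv (g N j) t| ≤ C := fun N j t => by
    refine (hD j _ t).trans ((le_abs_self _).trans ?_)
    exact (Finset.single_le_sum (f := fun j => |D j|) (fun j _ => abs_nonneg _)
      (Finset.mem_univ j)).trans (le_add_of_nonneg_left (by positivity))
  have hb1 := fun N => abs_prodFun_le (hC1 N)
  have hb2 := fun N => norm_gradient_prodFun_le (hgs N) (hC1 N) (hC2 N)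
  have hm1 := fun N => memLp_of_bound (contDiff_prodFun (hgs N)).continuous (hb1 N)
  have hm2 := fun N => memLp_gradient_of_bound (contDiff_prodFun (hgs N)) (hb2 N)
  set p : ℕ → Pair (cube n) := fun N => WithLp.toLp 2 ((hm1 N).toLp _, (hm2 N).toLp _) with hp
  have hpt : ∀ N, p N ∈ testPairs (cube n) := fun N =>
    ⟨prodFun (g N), isTest_prodFun (hgs N) (δ := 1 / ((N : ℝ) + 1)) (by positivity)
      (fun j t ht => cutSin_eq_zero ht), (hm1 N).coeFn_toLp, (hm2 N).coeFn_toLp⟩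
  have hev : ∀ x ∈ cube n, ∀ j, ∀ᶠ N in Filter.atTop, g N j =ᶠ[𝓝 (x j)] sinMode (k j) :=
    fun x hx j => (Filter.tendsto_add_atTop_nat 1).eventually (eventually_cutSin_eq (k j) (hx j))
  have hl1 : Filter.Tendsto (fun N => (hm1 N).toLp _) Filter.atTop (𝓝 (toL2 n (mode k))) := by
    refine tendsto_Lp_of_bounded (C ^ n) (fun N => ?_) ?_
    · filter_upwards [(hm1 N).coeFn_toLp] with x hx
      rw [hx]; exact hb1 N x
    · filter_upwards [ae_all_iff.2 fun N => (hm1 N).coeFn_toLp, coeFn_toL2 (mode k),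
        ae_restrict_mem (measurableSet_cube n)] with x h1 h2 h3
      simp_rw [h1, h2]
      refine tendsto_const_nhds.congr' ?_
      filter_upwards [Filter.eventually_all.2 (hev x h3)] with N hN
      change ∏ j, sinMode (k j) (x j) = ∏ j, g N j (x j)
      exact Finset.prod_congr rfl fun j _ => (hN j).eq_of_nhds.symm
  have hl2 : Filter.Tendsto (fun N => (hm2 N).toLp _) Filter.atTop
      (𝓝 ((memLp_gradient_modeFun k).toLp _)) := by
    refine tendsto_Lp_of_bounded (n * C ^ n) (fun N => ?_) ?_
    · filter_upwards [(hm2 N).coeFn_toLp] with x hx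
      rw [hx]; exact hb2 N x
    · filter_upwards [ae_all_iff.2 fun N => (hm2 N).coeFn_toLp,
        (memLp_gradient_modeFun k).coeFn_toLp,
        ae_restrict_mem (measurableSet_cube n)] with x h1 h2 h3
      simp_rw [h1, h2]
      refine tendsto_const_nhds.congr' ?_
      filter_upwards [Filter.eventually_all.2 (hev x h3)] with N hN
      rw [show modeFun k = prodFun fun j => sinMode (k j) from rfl,
        gradient_prodFun fun j => contDiff_sinMode (k j), gradient_prodFun (hgs N)]
      refine Finset.sum_congr rfl fun i _ => ?_
      rw [partialFactors, partialFactors, prodFun_update, prodFun_update, (hN i).deriv_eq]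
      congr 2
      exact Finset.prod_congr rfl fun j _ => (hN j).eq_of_nhds.symm
  have hl : Filter.Tendsto p Filter.atTop (𝓝 (modePair k)) :=
    ((WithLp.prod_continuous_toLp 2 _ _).tendsto _).comp (hl1.prodMk_nhds hl2)
  exact mem_closure_of_tendsto hl (.of_forall hpt)

/-- The eigenfunction `modeFun k` as an element of `H¹₀`. -/
def modeH10 {n : ℕ} (k : Fin n → ℕ) : H10 (cube n) := ⟨modePair k, modePair_mem_H10 k⟩

/-- The Dirichlet eigenvalue `π² ∑ⱼ (kⱼ + 1)²`. -/
def eigval {n : ℕ} (k : Fin n → ℕ) : ℝ := ∑ j, (Real.pi * (k j + 1)) ^ 2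

theorem fderiv_fderiv_modeFun {n : ℕ} (k : Fin n → ℕ) (x : E n) (i : Fin n) :
    fderiv ℝ (fun y => fderiv ℝ (modeFun k) y (EuclideanSpace.single i 1)) x
      (EuclideanSpace.single i 1) = -(Real.pi * (k i + 1)) ^ 2 * modeFun k x := by
  set g : Fin n → ℝ → ℝ := fun j => sinMode (k j) with hg
  have hgs : ∀ j, ContDiff ℝ ∞ (g j) := fun j => contDiff_sinMode (k j)
  have e : (fun y => fderiv ℝ (modeFun k) y (EuclideanSpace.single i 1)) =
      prodFun (partialFactors g i) := funext fun y => fderiv_prodFun_single hgs y i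
  have e2 : partialFactors (partialFactors g i) i = Function.update g i (deriv (deriv (g i))) := by
    rw [partialFactors, partialFactors, Function.update_self, Function.update_idem]
  have e3 : modeFun k x = prodFun (Function.update g i (g i)) x := by
    rw [Function.update_eq_self]; rfl
  rw [e, fderiv_prodFun_single (contDiff_partialFactors hgs i), e2, e3, prodFun_update,
    prodFun_update, hg, deriv_deriv_sinMode]
  ring

/-- Integration by parts against a test function. -/
theorem integral_inner_gradient_modeFun {n : ℕ} (k : Fin n → ℕ) {ψ : E n → ℝ}
    (hψ : IsTest (cube n) ψ) :
    ∫ x in cube n, ⟪gradient (modeFun k) x, gradient ψ x⟫ =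
      eigval k * ∫ x in cube n, modeFun k x * ψ x := by
  obtain ⟨hψs, hψc, hψt⟩ := hψ
  have hψ1 : ContDiff ℝ 1 ψ := hψs.of_le (by exact_mod_cast le_top)
  set e : Fin n → E n := fun i => EuclideanSpace.single i 1 with he
  set f : Fin n → E n → ℝ := fun i y => fderiv ℝ (modeFun k) y (e i) with hf
  have hfs : ∀ i, ContDiff ℝ ∞ (f i) := fun i =>
    ((contDiff_modeFun k).fderiv_right (m := ∞) (by simp)).clm_apply contDiff_const
  have hdψ : ∀ i, Continuous fun x => fderiv ℝ ψ x (e i) := fun i =>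
    (hψ1.continuous_fderiv one_ne_zero).clm_apply continuous_const
  have hsupp : ∀ i, HasCompactSupport fun x => fderiv ℝ ψ x (e i) := fun i =>
    hψc.fderiv_apply (𝕜 := ℝ) (e i)
  have hi1 : ∀ i, Integrable (fun x => f i x * fderiv ℝ ψ x (e i)) := fun i =>
    ((hfs i).continuous.mul (hdψ i)).integrable_of_hasCompactSupport ((hsupp i).mul_left)
  have hψ0 : ∀ x ∉ cube n, ψ x = 0 := fun x hx =>
    image_eq_zero_of_notMem_tsupport fun h => hx (hψt h)
  have hdψ0 : ∀ i, ∀ x ∉ cube n, fderiv ℝ ψ x (e i) = 0 := fun i x hx => by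
    rw [fderiv_of_notMem_tsupport (𝕜 := ℝ) fun h => hx (hψt h)]; rfl
  have hinner : ∀ x, ⟪gradient (modeFun k) x, gradient ψ x⟫ = ∑ i, f i x * fderiv ℝ ψ x (e i) := by
    intro x
    rw [← (EuclideanSpace.basisFun (Fin n) ℝ).sum_inner_mul_inner]
    refine Finset.sum_congr rfl fun i _ => ?_
    rw [inner_gradient_left, EuclideanSpace.basisFun_apply, real_inner_comm, inner_gradient_left]
  have hcalc : ∀ i, ∫ x, f i x * fderiv ℝ ψ x (e i) =
      (Real.pi * (k i + 1)) ^ 2 * ∫ x, modeFun k x * ψ x := by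
    intro i
    rw [integral_mul_fderiv_eq_neg_fderiv_mul_of_integrable _ (hi1 i) _
      (fun x _ => (hfs i).differentiable (by simp) x) (fun x _ => hψ1.differentiable one_ne_zero x)]
    · rw [← integral_const_mul, ← integral_neg]
      refine integral_congr_ae (.of_forall fun x => ?_)
      simp only [hf, he]
      rw [fderiv_fderiv_modeFun]
      ring
    · exact ((((hfs i).continuous_fderiv (by simp)).clm_apply continuous_const).mul
        hψs.continuous).integrable_of_hasCompactSupport hψc.mul_left
    · exact ((hfs i).continuous.mul hψs.continuous).integrable_of_hasCompactSupport hψc.mul_left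
  have hr : ∫ x in cube n, modeFun k x * ψ x = ∫ x, modeFun k x * ψ x :=
    setIntegral_eq_integral_of_forall_compl_eq_zero fun x hx => by rw [hψ0 x hx, mul_zero]
  have hl : ∫ x in cube n, ⟪gradient (modeFun k) x, gradient ψ x⟫ =
      ∫ x, ∑ i, f i x * fderiv ℝ ψ x (e i) :=
    (integral_congr_ae (.of_forall hinner)).trans
      (setIntegral_eq_integral_of_forall_compl_eq_zero fun x hx =>
        Finset.sum_eq_zero fun i _ => by rw [hdψ0 i x hx, mul_zero])
  rw [hl, integral_finsetSum _ fun i _ => hi1 i, hr, eigval, Finset.sum_mul]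
  exact Finset.sum_congr rfl fun i _ => hcalc i

theorem inner_gradient_modeH10 {n : ℕ} (k : Fin n → ℕ) (v : H10 (cube n)) :
    ⟪(modeH10 k).1.snd, v.1.snd⟫ = eigval k * ⟪toL2 n (mode k), v.1.fst⟫ := by
  obtain ⟨v, hv⟩ := v
  change ⟪(modePair k).snd, v.snd⟫ = eigval k * ⟪toL2 n (mode k), v.fst⟫
  have hcl : IsClosed {w : Pair (cube n) |
      ⟪(modePair k).snd, w.snd⟫ = eigval k * ⟪toL2 n (mode k), w.fst⟫} := by
    have h1 : Continuous fun w : Pair (cube n) => w.snd := WithLp.continuous_snd 2 _ _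
    have h2 : Continuous fun w : Pair (cube n) => w.fst := WithLp.continuous_fst 2 _ _
    exact isClosed_eq (by fun_prop) (by fun_prop)
  refine closure_minimal ?_ hcl hv
  rintro w ⟨ψ, hψ, h1, h2⟩
  have e1 : ⟪(modePair k).snd, w.snd⟫ =
      ∫ x in cube n, ⟪gradient (modeFun k) x, gradient ψ x⟫ := by
    rw [L2.inner_def]
    refine integral_congr_ae ?_
    filter_upwards [h2, (memLp_gradient_modeFun k).coeFn_toLp] with x hx hx'
    rw [hx]
    congr 1
  have e2 : ⟪toL2 n (mode k), w.fst⟫ = ∫ x in cube n, modeFun k x * ψ x := by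
    rw [inner_toL2]
    refine integral_congr_ae ?_
    filter_upwards [h1] with x hx
    rw [hx, mode_apply]
  change ⟪(modePair k).snd, w.snd⟫ = eigval k * ⟪toL2 n (mode k), w.fst⟫
  rw [e1, e2, integral_inner_gradient_modeFun k hψ]

theorem isDirichletEigen_mode {n : ℕ} (k : Fin n → ℕ) :
    IsDirichletEigen (cube n) (eigval k) (toL2 n (mode k)) :=
  ⟨modeH10 k, rfl, inner_gradient_modeH10 k⟩

/-! ### The spectral inequality -/

/-- The finitely many indices with eigenvalue at most `Lam`. -/
def lowModes (n : ℕ) (Lam : ℝ) : Finset (Fin n → ℕ) :=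
  (Fintype.piFinset fun _ => Finset.range ⌊√Lam⌋₊).filter fun k => eigval k ≤ Lam

theorem lt_floor_of_eigval_le {n : ℕ} {Lam : ℝ} {k : Fin n → ℕ} (h : eigval k ≤ Lam) (j : Fin n) :
    k j < ⌊√Lam⌋₊ := by
  have h1 : (Real.pi * (k j + 1)) ^ 2 ≤ eigval k :=
    Finset.single_le_sum (f := fun j => (Real.pi * ((k j : ℝ) + 1)) ^ 2)
      (fun j _ => sq_nonneg _) (Finset.mem_univ j)
  have h2 : ((k j : ℝ) + 1) ≤ Real.pi * (k j + 1) :=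
    le_mul_of_one_le_left (by positivity) (by linarith [Real.pi_gt_three])
  have h3 : ((k j + 1 : ℕ) : ℝ) ≤ √Lam := by
    push_cast
    refine h2.trans (Real.le_sqrt_of_sq_le (h1.trans h))
  exact Nat.lt_of_succ_le (Nat.le_floor h3)

@[simp]
theorem mem_lowModes {n : ℕ} {Lam : ℝ} {k : Fin n → ℕ} : k ∈ lowModes n Lam ↔ eigval k ≤ Lam := by
  simp only [lowModes, Finset.mem_filter, Fintype.mem_piFinset, Finset.mem_range,
    and_iff_right_iff_imp]
  exact lt_floor_of_eigval_le

theorem spectralProj_cube {n : ℕ} (Lam : ℝ) (u : L2 (cube n)) :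
    spectralProj (cube n) Lam u =
      toL2 n (∑ k ∈ lowModes n Lam, ⟪toL2 n (mode k), u⟫ • mode k) := by
  have h := hasSum_spectralProj (modeBasis n) eigval
    (fun k => by rw [modeBasis_apply]; exact isDirichletEigen_mode k) Lam u
  refine h.unique ?_
  rw [map_sum]
  have e : ∀ k ∈ lowModes n Lam, toL2 n (⟪toL2 n (mode k), u⟫ • mode k) =
      {k | eigval k ≤ Lam}.indicator (fun k => ⟪modeBasis n k, u⟫ • modeBasis n k) k := by
    intro k hk
    rw [indicator_of_mem (by exact mem_lowModes.1 hk), map_smul, modeBasis_apply]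
  rw [Finset.sum_congr rfl e]
  refine hasSum_sum_of_ne_finset_zero fun k hk => ?_
  exact indicator_of_notMem (s := {k | eigval k ≤ Lam}) (fun h => hk (mem_lowModes.2 h)) _

theorem isPointwiseRep_indicator {n : ℕ} (F : BoundedContinuousFunction (E n) ℝ) :
    IsPointwiseRep (cube n) (toL2 n F) ((cube n).indicator F) := by
  refine ⟨F.continuous.continuousOn.congr fun x hx => indicator_of_mem hx _, ?_,
    fun x hx => indicator_of_notMem hx _⟩
  filter_upwards [coeFn_toL2 F, ae_restrict_mem (measurableSet_cube n)] with x hx hc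
  rw [hx, indicator_of_mem hc]

theorem enorm_boundedContinuousFunction_le {X : Type*} [TopologicalSpace X]
    {F : BoundedContinuousFunction X ℝ} {c : ℝ≥0∞} (h : ∀ x, ‖F x‖ₑ ≤ c) : ‖F‖ₑ ≤ c := by
  rcases eq_or_ne c ∞ with rfl | hc
  · exact le_top
  · rw [← ofReal_norm, ENNReal.ofReal_le_iff_le_toReal hc]
    refine (F.norm_le ENNReal.toReal_nonneg).2 fun x => ?_
    rw [← ENNReal.ofReal_le_iff_le_toReal hc, ofReal_norm]
    exact h x

theorem enorm_toL2_le {n : ℕ} (F : BoundedContinuousFunction (E n) ℝ) : ‖toL2 n F‖ₑ ≤ ‖F‖ₑ := by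
  rw [← ofReal_norm, ← ofReal_norm]
  exact ENNReal.ofReal_le_ofReal (norm_toL2_le F)

theorem enorm_gridPt_le_iSup {n : ℕ} {α : ℝ} (hα : 0 < α) (F : E n → ℝ) (i : Fin n → ℕ) :
    ‖F (gridPt α i)‖ₑ ≤ ⨆ x ∈ omegaPow n α, ‖(cube n).indicator F x‖ₑ := by
  refine le_trans (le_of_eq ?_) (le_iSup₂ (gridPt α i) (gridPt_mem_omegaPow α i))
  rw [indicator_of_mem (gridPt_mem_cube hα i)]

/-- The spectral inequality with the supremum norm on the left: a combination of eigenfunctions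
with eigenvalues at most `Lam` is controlled by a bound `S` for its values on the grid. -/
def SupSpecIneq (n : ℕ) (α β C : ℝ) : Prop :=
  ∀ Lam : ℝ, 0 < Lam → ∀ (a : (Fin n → ℕ) → ℝ) (S : ℝ≥0∞),
    (∀ i, ‖(∑ k ∈ lowModes n Lam, a k • mode k) (gridPt α i)‖ₑ ≤ S) →
    ‖∑ k ∈ lowModes n Lam, a k • mode k‖ₑ ≤ ENNReal.ofReal (C * Real.exp (C * Lam ^ β)) * S

theorem exists_supSpecIneq (n : ℕ) {α β : ℝ} (hα : 0 < α) (hβ : 1 / 2 < β) :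
    ∃ C : ℝ, 1 ≤ C ∧ SupSpecIneq n α β C := by
  obtain ⟨C, hC1, hC⟩ := exists_gridConst_le n hα hβ
  refine ⟨C, hC1, fun Lam hLam a S hS => enorm_boundedContinuousFunction_le fun x => ?_⟩
  have e : ∀ y : E n, (∑ k ∈ lowModes n Lam, a k • mode k) y =
      ∑ k ∈ lowModes n Lam, a k * modeFun k y := by
    intro y
    simp [BoundedContinuousFunction.sum_apply]
  simp only [e] at hS ⊢
  refine (enorm_sum_modeFun_le hα (fun k hk => lt_floor_of_eigval_le (mem_lowModes.1 hk)) a x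
    hS).trans ?_
  exact mul_le_mul_left (ENNReal.ofReal_le_ofReal (hC Lam hLam)) _

theorem exists_specIneq (n : ℕ) {α β : ℝ} (hα : 0 < α) (hβ : 1 / 2 < β) :
    ∃ C : ℝ, 0 < C ∧ SpecIneq (cube n) (omegaPow n α) C β := by
  obtain ⟨C, hC1, hC⟩ := exists_supSpecIneq n hα hβ
  refine ⟨C, by linarith, fun Lam hLam u => ?_⟩
  rw [spectralProj_cube]
  refine ⟨_, isPointwiseRep_indicator _, (enorm_toL2_le _).trans ?_⟩
  exact hC Lam hLam _ _ fun i => enorm_gridPt_le_iSup hα _ i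

/-! ### The heat flow of the cube -/

theorem eigval_nonneg {n : ℕ} (k : Fin n → ℕ) : 0 ≤ eigval k := by
  unfold eigval; positivity

theorem sum_range_exp_le {τ : ℝ} (hτ : 0 < τ) (M : ℕ) :
    ∑ m ∈ Finset.range M, Real.exp (-((Real.pi * (m + 1)) ^ 2 * τ)) ≤ 1 / τ := by
  have h1 : ∀ m : ℕ, Real.exp (-((Real.pi * (m + 1)) ^ 2 * τ)) ≤ Real.exp (-τ) * Real.exp (-τ) ^ m := by
    intro m
    rw [← pow_succ', ← Real.exp_nat_mul, Real.exp_le_exp]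
    push_cast
    have h2 : ((m : ℝ) + 1) ≤ (Real.pi * (m + 1)) ^ 2 := by
      have := Real.pi_gt_three
      have hm : (1 : ℝ) ≤ m + 1 := by linarith [Nat.cast_nonneg (α := ℝ) m]
      have h3 : (m : ℝ) + 1 ≤ Real.pi * (m + 1) := le_mul_of_one_le_left (by linarith) (by linarith)
      nlinarith
    nlinarith
  have hq : Real.exp (-τ) < 1 := by rw [Real.exp_lt_one_iff]; linarith
  have hs := (hasSum_geometric_of_lt_one (Real.exp_pos (-τ)).le hq).mul_left (Real.exp (-τ))
  refine (Finset.sum_le_sum fun m _ => h1 m).trans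
    ((hs.summable.sum_le_tsum _ fun m _ => by positivity).trans ?_)
  rw [hs.tsum_eq, ← div_eq_mul_inv, div_le_div_iff₀ (by linarith) hτ, Real.exp_neg]
  have := Real.add_one_le_exp τ
  have h0 := Real.exp_pos τ
  have h5 : Real.exp τ * (Real.exp τ)⁻¹ = 1 := mul_inv_cancel₀ h0.ne'
  have h6 : 0 < (Real.exp τ)⁻¹ := by positivity
  nlinarith

theorem sum_exp_eigval_le {n : ℕ} {τ : ℝ} (hτ : 0 < τ) (s : Finset (Fin n → ℕ)) :
    ∑ k ∈ s, Real.exp (-(eigval k * τ)) ≤ (1 / τ) ^ n := by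
  obtain ⟨M, hM⟩ : ∃ M, s ⊆ Fintype.piFinset fun _ => Finset.range M := by
    refine ⟨(s.sup fun k => Finset.univ.sup k) + 1, fun k hk => ?_⟩
    rw [Fintype.mem_piFinset]
    intro j
    rw [Finset.mem_range, Nat.lt_succ_iff]
    exact (Finset.le_sup (f := k) (Finset.mem_univ j)).trans
      (Finset.le_sup (f := fun k => Finset.univ.sup k) hk)
  refine (Finset.sum_le_sum_of_subset_of_nonneg hM fun _ _ _ => (Real.exp_pos _).le).trans ?_
  have e : ∀ k : Fin n → ℕ, Real.exp (-(eigval k * τ)) =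
      ∏ j, Real.exp (-((Real.pi * (k j + 1)) ^ 2 * τ)) := by
    intro k
    rw [← Real.exp_sum, eigval, Finset.sum_mul, Finset.sum_neg_distrib]
  simp only [e]
  rw [← Finset.prod_univ_sum (fun _ => Finset.range M)
    (fun (_ : Fin n) (m : ℕ) => Real.exp (-((Real.pi * (m + 1)) ^ 2 * τ)))]
  calc _ ≤ ∏ _j : Fin n, 1 / τ :=
        Finset.prod_le_prod (fun _ _ => Finset.sum_nonneg fun _ _ => (Real.exp_pos _).le)
          fun _ _ => sum_range_exp_le hτ M
    _ = (1 / τ) ^ n := by simp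

theorem summable_exp_eigval {n : ℕ} {τ : ℝ} (hτ : 0 < τ) :
    Summable fun k : Fin n → ℕ => Real.exp (-(eigval k * τ)) :=
  summable_of_sum_le (fun _ => (Real.exp_pos _).le) fun s => sum_exp_eigval_le hτ s

/-- The trace of the heat semigroup is at most `τ ^ (-n)`. -/
theorem tsum_exp_eigval_le {n : ℕ} {τ : ℝ} (hτ : 0 < τ) :
    ∑' k : Fin n → ℕ, Real.exp (-(eigval k * τ)) ≤ (1 / τ) ^ n :=
  Real.tsum_le_of_sum_le (fun _ => (Real.exp_pos _).le) fun s => sum_exp_eigval_le hτ s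

/-- The coefficient of `f` along the `k`-th eigenfunction. -/
def coef {n : ℕ} (f : L2 (cube n)) (k : Fin n → ℕ) : ℝ := ⟪toL2 n (mode k), f⟫

theorem norm_toL2_mode {n : ℕ} (k : Fin n → ℕ) : ‖toL2 n (mode k)‖ = 1 := (orthonormal_mode n).1 k

theorem abs_coef_le {n : ℕ} (f : L2 (cube n)) (k : Fin n → ℕ) : |coef f k| ≤ ‖f‖ := by
  refine (abs_real_inner_le_norm _ _).trans ?_
  rw [norm_toL2_mode, one_mul]

theorem hasSum_coef_sq {n : ℕ} (f : L2 (cube n)) : HasSum (fun k => coef f k ^ 2) (‖f‖ ^ 2) := by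
  have h := (modeBasis n).hasSum_inner_mul_inner f f
  rw [real_inner_self_eq_norm_sq] at h
  refine h.congr_fun fun k => ?_
  rw [modeBasis_apply, real_inner_comm, coef, sq]

theorem hasSum_coef_smul {n : ℕ} (f : L2 (cube n)) :
    HasSum (fun k => coef f k • toL2 n (mode k)) f := by
  have h := (modeBasis n).hasSum_repr f
  refine h.congr_fun fun k => ?_
  rw [(modeBasis n).repr_apply_apply, modeBasis_apply, coef]

theorem norm_smul_mode_le {n : ℕ} (a : ℝ) (k : Fin n → ℕ) : ‖a • mode k‖ ≤ √2 ^ n * |a| := by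
  rw [norm_smul, Real.norm_eq_abs, mul_comm]
  exact mul_le_mul_of_nonneg_right (norm_mode_le k) (abs_nonneg a)

theorem eq_toL2_tsum_of_coef {n : ℕ} {f : L2 (cube n)} (h : Summable fun k => |coef f k|) :
    f = toL2 n (∑' k, coef f k • mode k) := by
  have hs : Summable fun k => coef f k • mode k :=
    Summable.of_norm_bounded (h.mul_left (√2 ^ n)) fun k => norm_smul_mode_le _ k
  have h1 := hs.hasSum.mapL (toL2 n)
  refine (hasSum_coef_smul f).unique (h1.congr_fun fun k => ?_)
  rw [map_smul]

/-- The heat flow at time `τ > 0`, a smoothing operator from `L²` to bounded continuous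
functions. -/
def heatFlow {n : ℕ} (τ : ℝ) (f : L2 (cube n)) : BoundedContinuousFunction (E n) ℝ :=
  ∑' k, (Real.exp (-(eigval k * τ)) * coef f k) • mode k

theorem norm_heatFlow_term_le {n : ℕ} (τ : ℝ) (f : L2 (cube n)) (k : Fin n → ℕ) :
    ‖(Real.exp (-(eigval k * τ)) * coef f k) • mode k‖ ≤
      √2 ^ n * ‖f‖ * Real.exp (-(eigval k * τ)) := by
  refine (norm_smul_mode_le _ k).trans ?_
  rw [abs_mul, abs_of_pos (Real.exp_pos _), mul_assoc]
  refine mul_le_mul_of_nonneg_left ?_ (by positivity)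
  rw [mul_comm]
  exact mul_le_mul_of_nonneg_right (abs_coef_le f k) (Real.exp_pos _).le

theorem summable_heatFlow {n : ℕ} {τ : ℝ} (hτ : 0 < τ) (f : L2 (cube n)) :
    Summable fun k => (Real.exp (-(eigval k * τ)) * coef f k) • mode k :=
  Summable.of_norm_bounded ((summable_exp_eigval hτ).mul_left _) (norm_heatFlow_term_le τ f)

theorem norm_heatFlow_le {n : ℕ} {τ : ℝ} (hτ : 0 < τ) (f : L2 (cube n)) :
    ‖heatFlow τ f‖ ≤ √2 ^ n * ‖f‖ * (1 / τ) ^ n := by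
  refine (tsum_of_norm_bounded ((summable_exp_eigval hτ).mul_left _).hasSum
    (norm_heatFlow_term_le τ f)).trans ?_
  rw [tsum_mul_left]
  exact mul_le_mul_of_nonneg_left (tsum_exp_eigval_le hτ) (by positivity)

/-- High frequencies decay like `exp (-Lam τ / 2)`, with half of the time left for smoothing. -/
theorem norm_heatFlow_sub_low_le {n : ℕ} {τ : ℝ} (hτ : 0 < τ) (f : L2 (cube n)) (Lam : ℝ) :
    ‖heatFlow τ f - ∑ k ∈ lowModes n Lam, (Real.exp (-(eigval k * τ)) * coef f k) • mode k‖ ≤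
      √2 ^ n * ‖f‖ * (2 / τ) ^ n * Real.exp (-(Lam * τ / 2)) := by
  have hs := summable_heatFlow hτ f
  rw [heatFlow, ← hs.sum_add_tsum_compl (s := lowModes n Lam), add_sub_cancel_left]
  set a := √2 ^ n * ‖f‖ with ha
  have hsum := (summable_exp_eigval (n := n) (half_pos hτ)).mul_left
    (a * Real.exp (-(Lam * τ / 2)))
  have hb : ∀ k : ↥((lowModes n Lam : Set (Fin n → ℕ))ᶜ),
      ‖(Real.exp (-(eigval k.1 * τ)) * coef f k.1) • mode k.1‖ ≤
      a * Real.exp (-(Lam * τ / 2)) * Real.exp (-(eigval k.1 * (τ / 2))) := by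
    intro k
    refine (norm_heatFlow_term_le τ f k.1).trans ?_
    rw [mul_assoc a, ← Real.exp_add]
    refine mul_le_mul_of_nonneg_left (Real.exp_le_exp.2 ?_) (by positivity)
    have hk : Lam < eigval k.1 := not_le.1 fun h => k.2 (by simpa using h)
    nlinarith
  refine (tsum_of_norm_bounded (hsum.subtype _).hasSum hb).trans ?_
  refine (Summable.tsum_subtype_le _ _ (fun k => by positivity) hsum).trans ?_
  rw [tsum_mul_left]
  have h1 := tsum_exp_eigval_le (n := n) (half_pos hτ)
  rw [one_div_div] at h1
  calc a * Real.exp (-(Lam * τ / 2)) * ∑' k : Fin n → ℕ, Real.exp (-(eigval k * (τ / 2)))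
      ≤ a * Real.exp (-(Lam * τ / 2)) * (2 / τ) ^ n := by gcongr
    _ = _ := by ring

/-! ### The coefficients of a weak solution -/

/-- A test function with integral zero is the derivative of a test function. -/
theorem exists_isTest_deriv_eq {a b : ℝ} {θ : ℝ → ℝ} (hθ : IsTest (Ioo a b) θ)
    (h0 : ∫ t, θ t = 0) : ∃ χ, IsTest (Ioo a b) χ ∧ deriv χ = θ := by
  obtain ⟨hs, hc, ht⟩ := hθ
  rcases (tsupport θ).eq_empty_or_nonempty with he | hne
  · rw [tsupport_eq_empty_iff] at he
    exact ⟨fun _ => 0, IsTest.zero _, by rw [he]; funext t; simp⟩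
  obtain ⟨a', ha', hla⟩ := IsCompact.exists_isLeast hc hne
  obtain ⟨b', hb', hub⟩ := IsCompact.exists_isGreatest hc hne
  have hθ0 : ∀ t ∉ Icc a' b', θ t = 0 := fun t h =>
    image_eq_zero_of_notMem_tsupport fun h' => h ⟨hla h', hub h'⟩
  have hcont := hs.continuous
  have hint : Integrable θ := hcont.integrable_of_hasCompactSupport hc
  set χ : ℝ → ℝ := fun t => ∫ s in Iic t, θ s with hχ
  have hχ' : ∀ t, χ t = χ a' + ∫ s in a'..t, θ s := fun t => by
    rw [intervalIntegral.integral_Iic_sub_Iic hint.integrableOn hint.integrableOn |>.symm]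
    ring
  have hd : ∀ t, HasDerivAt χ (θ t) t := fun t => by
    rw [show χ = fun t => χ a' + ∫ s in a'..t, θ s from funext hχ']
    exact (hcont.integral_hasStrictDerivAt a' t).hasDerivAt.const_add _
  have hderiv : deriv χ = θ := funext fun t => (hd t).deriv
  have hχ0 : ∀ t ∉ Icc a' b', χ t = 0 := by
    intro t h
    rw [mem_Icc, not_and_or, not_le, not_le] at h
    rcases h with h | h
    · exact setIntegral_eq_zero_of_forall_eq_zero fun s hs => hθ0 s fun h' =>
        absurd h'.1 (not_le.2 (lt_of_le_of_lt hs h))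
    · rw [hχ, ← h0]
      exact setIntegral_eq_integral_of_forall_compl_eq_zero fun s hs => hθ0 s fun h' =>
        hs (h'.2.trans h.le)
  refine ⟨χ, ⟨?_, HasCompactSupport.intro isCompact_Icc hχ0, ?_⟩, hderiv⟩
  · rw [contDiff_infty_iff_deriv, hderiv]
    exact ⟨fun t => (hd t).differentiableAt, hs⟩
  · have hsub : tsupport χ ⊆ Icc a' b' :=
      closure_minimal (fun t h => by_contra fun h' => h (hχ0 t h')) isClosed_Icc
    refine hsub.trans ?_
    exact fun t h => ⟨(ht ha').1.trans_le h.1, h.2.trans_lt (ht hb').2⟩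

/-- The lemma of du Bois-Reymond: a continuous function with vanishing weak derivative is
constant. -/
theorem exists_eqOn_const_of_integral_deriv_mul_eq_zero {a b : ℝ} (hab : a < b) {g : ℝ → ℝ}
    (hg : ContinuousOn g (Icc a b))
    (h : ∀ θ, IsTest (Ioo a b) θ → ∫ t in Ioo a b, deriv θ t * g t = 0) :
    ∃ c, ∀ t ∈ Icc a b, g t = c := by
  have hgi : IntegrableOn g (Ioo a b) := hg.integrableOn_Icc.mono_set Ioo_subset_Icc_self
  have hmul : ∀ θ, IsTest (Ioo a b) θ → IntegrableOn (fun t => θ t * g t) (Ioo a b) := fun θ hθ =>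
    (hθ.1.continuous.continuousOn.mul hg).integrableOn_Icc.mono_set Ioo_subset_Icc_self
  obtain ⟨ρ, hρ, hρ1⟩ : ∃ ρ, IsTest (Ioo a b) ρ ∧ ∫ t, ρ t = 1 := by
    let f : ContDiffBump ((a + b) / 2) :=
      ⟨(b - a) / 8, (b - a) / 4, by linarith, by linarith⟩
    refine ⟨f.normed volume, ⟨f.contDiff_normed, f.hasCompactSupport_normed, ?_⟩, f.integral_normed⟩
    rw [f.tsupport_normed_eq, Real.closedBall_eq_Icc]
    intro t ht
    have h1 : (a + b) / 2 - (b - a) / 4 ≤ t := ht.1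
    have h2 : t ≤ (a + b) / 2 + (b - a) / 4 := ht.2
    exact ⟨by linarith, by linarith⟩
  set c := ∫ t in Ioo a b, ρ t * g t with hc
  have hgc : ContinuousOn (fun t => g t - c) (Ioo a b) :=
    (hg.mono Ioo_subset_Icc_self).sub continuousOn_const
  have hae : ∀ᵐ t : ℝ, t ∈ Ioo a b → g t - c = 0 := by
    refine isOpen_Ioo.ae_eq_zero_of_integral_contDiff_smul_eq_zero
      (hgc.locallyIntegrableOn measurableSet_Ioo) fun θ hθ1 hθ2 hθ3 => ?_
    have hθ : IsTest (Ioo a b) θ := ⟨hθ1, hθ2, hθ3⟩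
    have hout : ∀ t ∉ Ioo a b, θ t = 0 := fun t ht =>
      image_eq_zero_of_notMem_tsupport fun h' => ht (hθ3 h')
    set m := ∫ t, θ t with hm
    have hθi : Integrable θ := hθ1.continuous.integrable_of_hasCompactSupport hθ2
    have hρi : Integrable ρ := hρ.1.continuous.integrable_of_hasCompactSupport hρ.2.1
    obtain ⟨χ, hχ, hχd⟩ := exists_isTest_deriv_eq (hθ.add (hρ.const_mul (-m))) (by
      rw [integral_add hθi (hρi.const_mul _), integral_const_mul, hρ1]
      ring)
    have h1 := h χ hχ
    rw [hχd] at h1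
    have h2 : ∫ t in Ioo a b, θ t * g t = m * c := by
      have e : ∀ t, (θ t + -m * ρ t) * g t = θ t * g t - m * (ρ t * g t) := fun t => by ring
      simp only [e] at h1
      rw [integral_sub (hmul θ hθ) ((hmul ρ hρ).const_mul m), integral_const_mul] at h1
      linarith
    have h3 : ∫ t in Ioo a b, θ t = m :=
      setIntegral_eq_integral_of_forall_compl_eq_zero hout
    rw [← setIntegral_eq_integral_of_forall_compl_eq_zero (s := Ioo a b)
      fun t ht => by rw [hout t ht, zero_smul]]
    simp only [smul_eq_mul, mul_sub]
    rw [integral_sub (hmul θ hθ) (hθi.integrableOn.mul_const c), integral_mul_const, h2, h3,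
      sub_self]
  have heq : EqOn g (fun _ => c) (Ioo a b) := by
    refine Measure.eqOn_open_of_ae_eq (μ := volume) ?_ isOpen_Ioo (hg.mono Ioo_subset_Icc_self) continuousOn_const
    filter_upwards [(ae_restrict_iff' measurableSet_Ioo).2 hae] with t ht
    linarith
  refine ⟨c, heq.of_subset_closure hg continuousOn_const Ioo_subset_Icc_self ?_⟩
  rw [closure_Ioo hab.ne]

/-- A continuous function which solves `f' = -lam f` weakly is an exponential. -/
theorem eq_exp_mul_of_weak_ode {T lam : ℝ} (hT : 0 < T) {f : ℝ → ℝ} (hf : ContinuousOn f (Icc 0 T))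
    (h : ∀ θ, IsTest (Ioo 0 T) θ →
      ∫ t in Ioo 0 T, deriv θ t * f t = lam * ∫ t in Ioo 0 T, θ t * f t) :
    ∀ t ∈ Icc 0 T, f t = Real.exp (-(lam * t)) * f 0 := by
  have hexp : Continuous fun t : ℝ => Real.exp (lam * t) := by fun_prop
  have hg : ContinuousOn (fun t => Real.exp (lam * t) * f t) (Icc 0 T) := hexp.continuousOn.mul hf
  obtain ⟨c, hc⟩ := exists_eqOn_const_of_integral_deriv_mul_eq_zero hT hg (by
    intro χ hχ
    have hθ : IsTest (Ioo 0 T) fun t => Real.exp (lam * t) * χ t :=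
      ⟨ContDiff.mul (by fun_prop) hχ.1, hχ.2.1.mul_left,
        (tsupport_mul_subset_right).trans hχ.2.2⟩
    have h1 := h _ hθ
    have hd : ∀ t, deriv (fun t => Real.exp (lam * t) * χ t) t =
        lam * (Real.exp (lam * t) * χ t) + Real.exp (lam * t) * deriv χ t := by
      intro t
      have e1 : HasDerivAt (fun t : ℝ => Real.exp (lam * t)) (Real.exp (lam * t) * lam) t := by
        simpa using ((hasDerivAt_id t).const_mul lam).exp
      have e2 : HasDerivAt χ (deriv χ t) t := (hχ.1.differentiable (by simp) t).hasDerivAt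
      refine (e1.mul e2).deriv.trans ?_
      ring
    have hcd : Continuous (deriv χ) := hχ.1.continuous_deriv (by simp)
    have i1 : IntegrableOn (fun t => lam * (Real.exp (lam * t) * χ t * f t)) (Ioo 0 T) :=
      (continuousOn_const.mul ((hexp.mul hχ.1.continuous).continuousOn.mul hf)).integrableOn_Icc.mono_set
        Ioo_subset_Icc_self
    have i2 : IntegrableOn (fun t => deriv χ t * (Real.exp (lam * t) * f t)) (Ioo 0 T) :=
      (hcd.continuousOn.mul hg).integrableOn_Icc.mono_set Ioo_subset_Icc_self
    have e : ∀ t, deriv (fun t => Real.exp (lam * t) * χ t) t * f t =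
        lam * (Real.exp (lam * t) * χ t * f t) + deriv χ t * (Real.exp (lam * t) * f t) := by
      intro t
      rw [hd]
      ring
    simp only [e] at h1
    rw [integral_add i1 i2, integral_const_mul] at h1
    linarith)
  intro t ht
  have h0 := hc 0 ⟨le_rfl, hT.le⟩
  have h1 := hc t ht
  simp only [mul_zero, Real.exp_zero, one_mul] at h0
  rw [h0, ← h1, ← mul_assoc, ← Real.exp_add, neg_add_cancel, Real.exp_zero, one_mul]

theorem IsHeatSolution.coef_eq {n : ℕ} {T : ℝ} (hT : 0 < T) {u₀ : L2 (cube n)}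
    {u : ℝ → L2 (cube n)} (hu : IsHeatSolution (cube n) T u₀ u) (k : Fin n → ℕ) :
    ∀ t ∈ Icc 0 T, coef (u t) k = Real.exp (-(eigval k * t)) * coef u₀ k := by
  obtain ⟨hc, h0, U, U', -, -, hU, hw, he⟩ := hu
  have hcont : ContinuousOn (fun t => coef (u t) k) (Icc 0 T) := by
    unfold coef
    exact continuousOn_const.inner hc
  have h := eq_exp_mul_of_weak_ode (lam := eigval k) hT hcont (by
    intro θ hθ
    have h1 := hw θ hθ (modeH10 k)
    have e1 : ∫ t in Ioo 0 T, deriv θ t * ⟪(U t).1.fst, (modeH10 k).1.fst⟫ =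
        ∫ t in Ioo 0 T, deriv θ t * coef (u t) k := by
      refine integral_congr_ae ?_
      filter_upwards [hU] with t ht
      rw [ht, real_inner_comm]
      rfl
    have e2 : ∫ t in Ioo 0 T, θ t * U' t (modeH10 k) =
        -(eigval k * ∫ t in Ioo 0 T, θ t * coef (u t) k) := by
      rw [← integral_const_mul, ← integral_neg]
      refine integral_congr_ae ?_
      filter_upwards [hU, he (modeH10 k)] with t ht ht'
      rw [real_inner_comm, inner_gradient_modeH10, ht] at ht'
      change U' t (modeH10 k) + eigval k * coef (u t) k = 0 at ht'
      linear_combination θ t * ht'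
    rw [e1, e2, neg_neg] at h1
    exact h1)
  rw [h0] at h
  exact h

theorem heatFlow_coef_eq {n : ℕ} {τ : ℝ} (hτ : 0 < τ) {f g : L2 (cube n)}
    (h : ∀ k, coef g k = Real.exp (-(eigval k * τ)) * coef f k) : g = toL2 n (heatFlow τ f) := by
  have hs : Summable fun k => |coef g k| := by
    refine Summable.of_nonneg_of_le (fun _ => abs_nonneg _) (fun k => ?_)
      ((summable_exp_eigval hτ).mul_right ‖f‖)
    rw [h, abs_mul, abs_of_pos (Real.exp_pos _)]
    exact mul_le_mul_of_nonneg_left (abs_coef_le f k) (Real.exp_pos _).le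
  rw [eq_toL2_tsum_of_coef hs]
  simp only [h]
  rfl

/-! ### Existence of a weak solution -/

instance (n : ℕ) : CompleteSpace (H10 (cube n)) :=
  (Submodule.isClosed_topologicalClosure _).completeSpace_coe

/-- The continuous map `v ↦ v` from `H¹₀` to `L²`. -/
def H10.fstL (n : ℕ) : H10 (cube n) →L[ℝ] L2 (cube n) :=
  (WithLp.fstL 2 ℝ (L2 (cube n)) (L2vec (cube n))).comp (H10 (cube n)).subtypeL

/-- The continuous map `v ↦ ∇v` from `H¹₀` to `L²`. -/
def H10.sndL (n : ℕ) : H10 (cube n) →L[ℝ] L2vec (cube n) :=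
  (WithLp.sndL 2 ℝ (L2 (cube n)) (L2vec (cube n))).comp (H10 (cube n)).subtypeL

/-- The weak Dirichlet Laplacian `-Δ : H¹₀ → H⁻¹`, `w ↦ (v ↦ ∫ ∇w · ∇v)`. -/
def dirichletForm (n : ℕ) : H10 (cube n) →L[ℝ] Hneg1 (cube n) :=
  (isBoundedBilinearMap_inner (𝕜 := ℝ) (E := L2vec (cube n))).toContinuousLinearMap.bilinearComp
    (H10.sndL n) (H10.sndL n)

theorem dirichletForm_apply {n : ℕ} (w v : H10 (cube n)) :
    dirichletForm n w v = ⟪w.1.snd, v.1.snd⟫ := rfl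

theorem norm_dirichletForm_le {n : ℕ} (w : H10 (cube n)) : ‖dirichletForm n w‖ ≤ ‖w‖ := by
  refine ContinuousLinearMap.opNorm_le_bound _ (norm_nonneg _) fun v => ?_
  rw [dirichletForm_apply]
  refine (norm_inner_le_norm _ _).trans ?_
  exact mul_le_mul (WithLp.norm_snd_le _ _) (WithLp.norm_snd_le _ _) (norm_nonneg _) (norm_nonneg _)

theorem dirichletForm_modeH10 {n : ℕ} (k : Fin n → ℕ) (v : H10 (cube n)) :
    dirichletForm n (modeH10 k) v = eigval k * coef v.1.fst k :=
  inner_gradient_modeH10 k v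

theorem inner_modeH10 {n : ℕ} (k : Fin n → ℕ) (v : H10 (cube n)) :
    ⟪modeH10 k, v⟫ = (1 + eigval k) * coef v.1.fst k := by
  rw [Submodule.coe_inner, WithLp.prod_inner_apply, add_mul, one_mul]
  exact congrArg₂ (· + ·) rfl (inner_gradient_modeH10 k v)

theorem coef_mode {n : ℕ} (k l : Fin n → ℕ) :
    coef (toL2 n (mode k)) l = if l = k then 1 else 0 :=
  orthonormal_iff_ite.1 (orthonormal_mode n) l k

theorem norm_modeH10_le {n : ℕ} (k : Fin n → ℕ) : ‖modeH10 k‖ ≤ 1 + eigval k := by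
  have h : ‖modeH10 k‖ ^ 2 = 1 + eigval k := by
    rw [← real_inner_self_eq_norm_sq, inner_modeH10]
    change _ * coef (toL2 n (mode k)) k = _
    rw [coef_mode, if_pos rfl, mul_one]
  have := eigval_nonneg k
  have := norm_nonneg (modeH10 k)
  nlinarith

theorem coef_toL2_tsum {n : ℕ} {a : (Fin n → ℕ) → ℝ} (h : Summable fun k => a k • mode k)
    (l : Fin n → ℕ) : coef (toL2 n (∑' k, a k • mode k)) l = a l := by
  have h1 := (h.hasSum.mapL (toL2 n)).mapL (innerSL ℝ (toL2 n (mode l)))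
  refine h1.unique ?_
  have e : a l = (fun k => (innerSL ℝ (toL2 n (mode l))) (toL2 n (a k • mode k))) l := by
    simp only [innerSL_apply_apply, map_smul]
    rw [show ⟪toL2 n (mode l), toL2 n (mode l)⟫ = 1 by
      rw [real_inner_self_eq_norm_sq, norm_toL2_mode, one_pow]]
    simp
  rw [e]
  refine hasSum_single l fun k hk => ?_
  simp only [innerSL_apply_apply, map_smul]
  rw [(orthonormal_mode n).2 hk.symm]
  simp

theorem coef_heatFlow {n : ℕ} {τ : ℝ} (hτ : 0 < τ) (f : L2 (cube n)) (k : Fin n → ℕ) :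
    coef (toL2 n (heatFlow τ f)) k = Real.exp (-(eigval k * τ)) * coef f k :=
  coef_toL2_tsum (summable_heatFlow hτ f) k

/-- The weak solution of the heat equation with initial value `f`. -/
def heatSol {n : ℕ} (f : L2 (cube n)) (t : ℝ) : L2 (cube n) :=
  if 0 < t then toL2 n (heatFlow t f) else f

theorem coef_heatSol {n : ℕ} (f : L2 (cube n)) {t : ℝ} (ht : 0 ≤ t) (k : Fin n → ℕ) :
    coef (heatSol f t) k = Real.exp (-(eigval k * t)) * coef f k := by
  rcases ht.eq_or_lt with rfl | h
  · simp [heatSol]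
  · rw [heatSol, if_pos h, coef_heatFlow h]

theorem coef_sub {n : ℕ} (f g : L2 (cube n)) (k : Fin n → ℕ) :
    coef (f - g) k = coef f k - coef g k := inner_sub_right _ _ _

theorem continuousOn_heatSol {n : ℕ} (f : L2 (cube n)) (T : ℝ) :
    ContinuousOn (heatSol f) (Icc 0 T) := by
  intro s hs
  have hT : Filter.Tendsto (fun t => ∑' k, coef (heatSol f t - heatSol f s) k ^ 2)
      (𝓝[Icc 0 T] s) (𝓝 (∑' _k : Fin n → ℕ, (0 : ℝ))) := by
    refine tendsto_tsum_of_dominated_convergence (hasSum_coef_sq f).summable (fun k => ?_) ?_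
    · have hc : Continuous fun t : ℝ => (Real.exp (-(eigval k * t)) * coef f k -
          Real.exp (-(eigval k * s)) * coef f k) ^ 2 := by fun_prop
      have := (hc.continuousWithinAt (s := Icc 0 T) (x := s)).tendsto
      rw [sub_self, zero_pow two_ne_zero] at this
      refine this.congr' ?_
      filter_upwards [self_mem_nhdsWithin] with t ht
      rw [coef_sub, coef_heatSol f ht.1, coef_heatSol f hs.1]
    · filter_upwards [self_mem_nhdsWithin] with t ht k
      rw [coef_sub, coef_heatSol f ht.1, coef_heatSol f hs.1, ← sub_mul, mul_pow, norm_mul,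
        Real.norm_of_nonneg (sq_nonneg _), Real.norm_of_nonneg (sq_nonneg _)]
      refine mul_le_of_le_one_left (sq_nonneg _) ?_
      have h1 : ∀ r : ℝ, 0 ≤ r → Real.exp (-(eigval k * r)) ≤ 1 := fun r hr =>
        Real.exp_le_one_iff.2 (by have := mul_nonneg (eigval_nonneg k) hr; linarith)
      have h2 := h1 t ht.1
      have h3 := h1 s hs.1
      have h4 := Real.exp_pos (-(eigval k * t))
      have h5 := Real.exp_pos (-(eigval k * s))
      rw [sq_le_one_iff_abs_le_one, abs_le]
      exact ⟨by linarith, by linarith⟩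
  rw [tsum_zero] at hT
  rw [ContinuousWithinAt, tendsto_iff_norm_sub_tendsto_zero]
  have h2 : Filter.Tendsto (fun t => ‖heatSol f t - heatSol f s‖ ^ 2) (𝓝[Icc 0 T] s) (𝓝 0) := by
    refine hT.congr fun t => ?_
    rw [(hasSum_coef_sq _).tsum_eq]
  have h3 := h2.sqrt
  rw [Real.sqrt_zero] at h3
  exact h3.congr fun t => Real.sqrt_sq (norm_nonneg _)

/-- The weak solution at time `t > 0`, as an element of `H¹₀`. -/
def heatSolH10 {n : ℕ} (f : L2 (cube n)) (t : ℝ) : H10 (cube n) :=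
  ∑' k, (Real.exp (-(eigval k * t)) * coef f k) • modeH10 k

theorem summable_heatSolH10 {n : ℕ} (f : L2 (cube n)) {t : ℝ} (ht : 0 < t) :
    Summable fun k => (Real.exp (-(eigval k * t)) * coef f k) • modeH10 k := by
  refine Summable.of_norm_bounded ((summable_exp_eigval (n := n) (half_pos ht)).mul_right
    ((1 + 2 / t) * ‖f‖)) fun k => ?_
  rw [norm_smul, norm_mul, Real.norm_of_nonneg (Real.exp_pos _).le, Real.norm_eq_abs]
  have hlam := eigval_nonneg k
  -- `1 + lam ≤ (1 + 2 / t) exp (lam t / 2)`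
  have h1 : 1 + eigval k ≤ (1 + 2 / t) * Real.exp (eigval k * (t / 2)) := by
    have h2 := Real.add_one_le_exp (eigval k * (t / 2))
    have h3 : eigval k = 2 / t * (eigval k * (t / 2)) := by field_simp
    have h4 : 0 < 2 / t := by positivity
    have h5 : 0 ≤ eigval k * (t / 2) := by positivity
    calc 1 + eigval k = 1 + 2 / t * (eigval k * (t / 2)) := by rw [← h3]
      _ ≤ (1 + 2 / t) * (eigval k * (t / 2) + 1) := by nlinarith
      _ ≤ _ := by gcongr
  have h6 : Real.exp (-(eigval k * t)) * Real.exp (eigval k * (t / 2)) =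
      Real.exp (-(eigval k * (t / 2))) := by
    rw [← Real.exp_add]
    congr 1
    ring
  calc Real.exp (-(eigval k * t)) * |coef f k| * ‖modeH10 k‖
      ≤ Real.exp (-(eigval k * t)) * ‖f‖ * ((1 + 2 / t) * Real.exp (eigval k * (t / 2))) := by
        gcongr
        · exact abs_coef_le f k
        · exact (norm_modeH10_le k).trans h1
    _ = (Real.exp (-(eigval k * t)) * Real.exp (eigval k * (t / 2))) * ((1 + 2 / t) * ‖f‖) := by ring
    _ = _ := by rw [h6]

theorem heatSolH10_fst {n : ℕ} (f : L2 (cube n)) {t : ℝ} (ht : 0 < t) :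
    (heatSolH10 f t).1.fst = heatSol f t := by
  have h1 := (summable_heatSolH10 f ht).hasSum.mapL (H10.fstL n)
  have h2 := (summable_heatFlow ht f).hasSum.mapL (toL2 n)
  rw [heatSol, if_pos ht]
  refine h1.unique (h2.congr_fun fun k => ?_)
  rw [map_smul, map_smul]
  rfl

theorem hasSum_dirichletForm_heatSolH10 {n : ℕ} (f : L2 (cube n)) {t : ℝ} (ht : 0 < t)
    (v : H10 (cube n)) : HasSum (fun k => Real.exp (-(eigval k * t)) * coef f k *
      (eigval k * coef v.1.fst k)) (dirichletForm n (heatSolH10 f t) v) := by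
  have h1 := (summable_heatSolH10 f ht).hasSum.mapL ((dirichletForm n).flip v)
  refine h1.congr_fun fun k => ?_
  rw [map_smul, ContinuousLinearMap.flip_apply, dirichletForm_modeH10, smul_eq_mul]

theorem hasSum_norm_sq_heatSolH10 {n : ℕ} (f : L2 (cube n)) {t : ℝ} (ht : 0 < t) :
    HasSum (fun k => (1 + eigval k) * Real.exp (-(2 * eigval k * t)) * coef f k ^ 2)
      (‖heatSolH10 f t‖ ^ 2) := by
  have h1 := (summable_heatSolH10 f ht).hasSum.mapL (innerSL ℝ (heatSolH10 f t))
  change HasSum _ (⟪heatSolH10 f t, heatSolH10 f t⟫) at h1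
  rw [real_inner_self_eq_norm_sq] at h1
  refine h1.congr_fun fun k => ?_
  rw [map_smul, innerSL_apply_apply, real_inner_comm, inner_modeH10, heatSolH10_fst f ht,
    coef_heatSol f ht.le, smul_eq_mul,
    show -(2 * eigval k * t) = -(eigval k * t) + -(eigval k * t) by ring, Real.exp_add]
  ring

theorem hasDerivAt_exp_neg_mul (lam t : ℝ) :
    HasDerivAt (fun t => Real.exp (-(lam * t))) (-(lam * Real.exp (-(lam * t)))) t := by
  have h : HasDerivAt (fun t : ℝ => -(lam * t)) (-lam) t := by
    simpa using (hasDerivAt_id t).const_mul (-lam)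
  refine h.exp.congr_deriv ?_
  ring

theorem integral_mul_exp_le_one (T : ℝ) (hT : 0 < T) (lam : ℝ) :
    ∫ t in Ioo 0 T, lam * Real.exp (-(lam * t)) ≤ 1 := by
  rw [← integral_Ioc_eq_integral_Ioo, ← intervalIntegral.integral_of_le hT.le,
    intervalIntegral.integral_eq_sub_of_hasDerivAt (f := fun t => -Real.exp (-(lam * t)))]
  · simp only [mul_zero, neg_zero, Real.exp_zero]
    linarith [Real.exp_pos (-(lam * T))]
  · exact fun t _ => (hasDerivAt_exp_neg_mul lam t).neg.congr_deriv (neg_neg _)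
  · exact Continuous.intervalIntegrable (by fun_prop) _ _

theorem integrableOn_Ioo_of_continuous {g : ℝ → ℝ} (hg : Continuous g) (T : ℝ) :
    IntegrableOn g (Ioo 0 T) :=
  hg.integrableOn_Icc.mono_set Ioo_subset_Icc_self

theorem aestronglyMeasurable_heatSolH10 {n : ℕ} (f : L2 (cube n)) (T : ℝ) :
    AEStronglyMeasurable (heatSolH10 f) (volume.restrict (Ioo 0 T)) := by
  refine aestronglyMeasurable_of_tendsto_ae (Filter.atTop : Filter (Finset (Fin n → ℕ)))
    (f := fun s t => ∑ k ∈ s, (Real.exp (-(eigval k * t)) * coef f k) • modeH10 k) (fun s => ?_) ?_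
  · have := secondCountableTopologyEither_of_left ℝ (H10 (cube n))
    exact Continuous.aestronglyMeasurable (by fun_prop)
  · filter_upwards [ae_restrict_mem measurableSet_Ioo] with t ht
    exact (summable_heatSolH10 f ht.1).hasSum

/-- The energy estimate `∫₀ᵀ ‖u(t)‖²_{H¹} dt ≤ (T + 1) ‖f‖²` holds term by term. -/
theorem memLp_heatSolH10 {n : ℕ} (f : L2 (cube n)) {T : ℝ} (hT : 0 < T) :
    MemLp (heatSolH10 f) 2 (volume.restrict (Ioo 0 T)) := by
  refine ⟨aestronglyMeasurable_heatSolH10 f T, ?_⟩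
  rw [eLpNorm_lt_top_iff_lintegral_rpow_enorm_lt_top (by norm_num) (by norm_num)]
  set b : (Fin n → ℕ) → ℝ → ℝ := fun k t =>
    (1 + eigval k) * Real.exp (-(2 * eigval k * t)) * coef f k ^ 2 with hb
  have hb0 : ∀ k t, 0 ≤ b k t := fun k t => by have := eigval_nonneg k; positivity
  have hbc : ∀ k, Continuous (b k) := fun k => by fun_prop
  have e1 : ∫⁻ t in Ioo 0 T, ‖heatSolH10 f t‖ₑ ^ (2 : ℝ≥0∞).toReal =
      ∫⁻ t in Ioo 0 T, ∑' k, ENNReal.ofReal (b k t) := by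
    refine setLIntegral_congr_fun measurableSet_Ioo fun t ht => ?_
    have h := hasSum_norm_sq_heatSolH10 f ht.1
    rw [← ENNReal.ofReal_tsum_of_nonneg (fun k => hb0 k t) h.summable, h.tsum_eq,
      ENNReal.ofReal_pow (norm_nonneg _), ofReal_norm]
    norm_num
  rw [e1, lintegral_tsum fun k => ((hbc k).measurable.ennreal_ofReal).aemeasurable]
  have e2 : ∀ k, ∫⁻ t in Ioo 0 T, ENNReal.ofReal (b k t) ≤
      ENNReal.ofReal ((T + 1) * coef f k ^ 2) := by
    intro k
    rw [← ofReal_integral_eq_lintegral_ofReal (integrableOn_Ioo_of_continuous (hbc k) T)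
      (.of_forall (hb0 k))]
    refine ENNReal.ofReal_le_ofReal ?_
    rw [integral_mul_const]
    refine mul_le_mul_of_nonneg_right ?_ (sq_nonneg _)
    have hlam := eigval_nonneg k
    have h1 : ∫ t in Ioo 0 T, (1 + eigval k) * Real.exp (-(2 * eigval k * t)) ≤
        ∫ t in Ioo 0 T, (1 + 2 * eigval k * Real.exp (-(2 * eigval k * t))) := by
      refine setIntegral_mono_on (integrableOn_Ioo_of_continuous (by fun_prop) T)
        (integrableOn_Ioo_of_continuous (by fun_prop) T) measurableSet_Ioo fun t ht => ?_
      have h2 : Real.exp (-(2 * eigval k * t)) ≤ 1 :=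
        Real.exp_le_one_iff.2 (by have := mul_nonneg hlam ht.1.le; linarith)
      have h3 := Real.exp_pos (-(2 * eigval k * t))
      nlinarith
    refine h1.trans ?_
    rw [integral_add (integrableOn_Ioo_of_continuous (by fun_prop) T)
      (integrableOn_Ioo_of_continuous (by fun_prop) T)]
    have h4 := integral_mul_exp_le_one T hT (2 * eigval k)
    have h5 : ∫ _t in Ioo 0 T, (1 : ℝ) = T := by simp [hT.le]
    linarith
  refine (ENNReal.tsum_le_tsum e2).trans_lt ?_
  have hs := (hasSum_coef_sq f).summable.mul_left (T + 1)
  rw [← ENNReal.ofReal_tsum_of_nonneg (fun k => by positivity) hs]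
  exact ENNReal.ofReal_lt_top

theorem summable_abs_coef_mul {n : ℕ} (f g : L2 (cube n)) :
    Summable fun k => |coef f k * coef g k| := by
  refine Summable.of_nonneg_of_le (fun _ => abs_nonneg _) (fun k => ?_)
    ((hasSum_coef_sq f).summable.add (hasSum_coef_sq g).summable)
  rw [abs_mul]
  nlinarith [sq_abs (coef f k), sq_abs (coef g k), sq_nonneg (|coef f k| - |coef g k|),
    sq_nonneg (|coef f k|), sq_nonneg (|coef g k|)]

theorem IsTest.integral_deriv_mul_exp {T : ℝ} {θ : ℝ → ℝ} (hθ : IsTest (Ioo 0 T) θ) (lam : ℝ) :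
    ∫ t in Ioo 0 T, deriv θ t * Real.exp (-(lam * t)) =
      ∫ t in Ioo 0 T, θ t * (lam * Real.exp (-(lam * t))) := by
  obtain ⟨h1, h2, h3⟩ := hθ
  have hd : Continuous (deriv θ) := h1.continuous_deriv (by simp)
  have h0 : ∀ t ∉ Ioo 0 T, θ t = 0 := fun t ht =>
    image_eq_zero_of_notMem_tsupport fun h' => ht (h3 h')
  have h0' : ∀ t ∉ Ioo 0 T, deriv θ t = 0 := fun t ht =>
    deriv_of_notMem_tsupport fun h' => ht (h3 h')
  rw [setIntegral_eq_integral_of_forall_compl_eq_zero fun t ht => by rw [h0' t ht, zero_mul],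
    setIntegral_eq_integral_of_forall_compl_eq_zero fun t ht => by rw [h0 t ht, zero_mul]]
  have hθd : ∀ t, HasDerivAt θ (deriv θ t) t := fun t =>
    (h1.differentiable (by simp) t).hasDerivAt
  have hce : Continuous fun t : ℝ => Real.exp (-(lam * t)) := by fun_prop
  have key := integral_mul_deriv_eq_deriv_mul_of_integrable (u := θ)
    (u' := deriv θ) (v := fun t => Real.exp (-(lam * t)))
    (v' := fun t => -(lam * Real.exp (-(lam * t))))
    (fun t _ => hθd t) (fun t _ => hasDerivAt_exp_neg_mul lam t)
    ((h1.continuous.mul (by fun_prop)).integrable_of_hasCompactSupport h2.mul_right)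
    ((hd.mul hce).integrable_of_hasCompactSupport h2.deriv.mul_right)
    ((h1.continuous.mul hce).integrable_of_hasCompactSupport h2.mul_right)
  simp only [mul_neg, integral_neg, neg_inj] at key
  exact key.symm

theorem isHeatSolution_heatSol {n : ℕ} {T : ℝ} (hT : 0 < T) (f : L2 (cube n)) :
    IsHeatSolution (cube n) T f (heatSol f) := by
  have hU' : MemLp (fun t => -dirichletForm n (heatSolH10 f t)) 2 (volume.restrict (Ioo 0 T)) := by
    have hm : AEStronglyMeasurable (fun t => -dirichletForm n (heatSolH10 f t))
        (volume.restrict (Ioo 0 T)) :=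
      (dirichletForm n).continuous.neg.comp_aestronglyMeasurable
        (aestronglyMeasurable_heatSolH10 f T)
    refine MemLp.of_le_mul (E := Hneg1 (cube n)) (c := 1) (memLp_heatSolH10 f hT) hm
      (.of_forall fun t => ?_)
    rw [one_mul]
    exact (norm_neg (dirichletForm n (heatSolH10 f t))).trans_le (norm_dirichletForm_le _)
  refine ⟨continuousOn_heatSol f T, by simp [heatSol], heatSolH10 f,
    fun t => -dirichletForm n (heatSolH10 f t), memLp_heatSolH10 f hT,
    hU', ?_, ?_, ?_⟩
  · filter_upwards [ae_restrict_mem measurableSet_Ioo] with t ht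
    exact heatSolH10_fst f ht.1
  · intro θ hθ v
    set c := fun k => coef f k * coef v.1.fst k with hc
    have hcs : Summable fun k => |c k| := summable_abs_coef_mul f v.1.fst
    have hθc := hθ.1.continuous
    have hθd : Continuous (deriv θ) := hθ.1.continuous_deriv (by simp)
    obtain ⟨M, hM⟩ := hθc.bounded_above_of_compact_support hθ.2.1
    obtain ⟨M', hM'⟩ := hθd.bounded_above_of_compact_support hθ.2.1.deriv
    have hM0 : 0 ≤ M := (norm_nonneg _).trans (hM 0)
    have hM0' : 0 ≤ M' := (norm_nonneg _).trans (hM' 0)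
    set F : (Fin n → ℕ) → ℝ → ℝ := fun k t => deriv θ t * Real.exp (-(eigval k * t)) * c k with hF
    set G : (Fin n → ℕ) → ℝ → ℝ :=
      fun k t => θ t * (eigval k * Real.exp (-(eigval k * t))) * c k with hG
    have hFi : ∀ k, Integrable (F k) (volume.restrict (Ioo 0 T)) := fun k =>
      integrableOn_Ioo_of_continuous (by fun_prop) T
    have hGi : ∀ k, Integrable (G k) (volume.restrict (Ioo 0 T)) := fun k =>
      integrableOn_Ioo_of_continuous (by fun_prop) T
    have hFs : Summable fun k => ∫ t in Ioo 0 T, ‖F k t‖ := by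
      refine Summable.of_nonneg_of_le (fun k => integral_nonneg fun _ => norm_nonneg _)
        (fun k => ?_) (hcs.mul_left (M' * T))
      have h1 : ∫ t in Ioo 0 T, ‖F k t‖ ≤ ∫ _t in Ioo 0 T, M' * |c k| := by
        refine setIntegral_mono_on (hFi k).norm (integrableOn_Ioo_of_continuous (by fun_prop) T)
          measurableSet_Ioo fun t ht => ?_
        rw [hF, norm_mul, norm_mul, Real.norm_of_nonneg (Real.exp_pos _).le, Real.norm_eq_abs (c k)]
        refine mul_le_mul_of_nonneg_right ?_ (abs_nonneg _)
        have h2 : Real.exp (-(eigval k * t)) ≤ 1 := Real.exp_le_one_iff.2 (by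
          have := mul_nonneg (eigval_nonneg k) ht.1.le; linarith)
        exact (mul_le_of_le_one_right (norm_nonneg _) h2).trans (hM' t)
      refine h1.trans (le_of_eq ?_)
      simp [hT.le]
      ring
    have hGs : Summable fun k => ∫ t in Ioo 0 T, ‖G k t‖ := by
      refine Summable.of_nonneg_of_le (fun k => integral_nonneg fun _ => norm_nonneg _)
        (fun k => ?_) (hcs.mul_left M)
      have hlam := eigval_nonneg k
      have h1 : ∫ t in Ioo 0 T, ‖G k t‖ ≤
          ∫ t in Ioo 0 T, M * |c k| * (eigval k * Real.exp (-(eigval k * t))) := by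
        refine setIntegral_mono_on (hGi k).norm (integrableOn_Ioo_of_continuous (by fun_prop) T)
          measurableSet_Ioo fun t ht => ?_
        have h0 : 0 ≤ eigval k * Real.exp (-(eigval k * t)) := by positivity
        rw [hG, norm_mul, norm_mul, Real.norm_of_nonneg h0, Real.norm_eq_abs (c k), mul_right_comm]
        exact mul_le_mul_of_nonneg_right
          (mul_le_mul_of_nonneg_right (hM t) (abs_nonneg _)) h0
      refine h1.trans ?_
      rw [integral_const_mul]
      exact mul_le_of_le_one_right (by positivity) (integral_mul_exp_le_one T hT _)
    have hF2 := hasSum_integral_of_summable_integral_norm hFi hFs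
    have hG2 := hasSum_integral_of_summable_integral_norm hGi hGs
    have hFG : ∀ k, ∫ t in Ioo 0 T, F k t = ∫ t in Ioo 0 T, G k t := fun k => by
      simp only [hF, hG]
      rw [integral_mul_const, integral_mul_const, hθ.integral_deriv_mul_exp]
    simp only [hFG] at hF2
    have e1 : ∫ t in Ioo 0 T, deriv θ t * ⟪(heatSolH10 f t).1.fst, v.1.fst⟫ =
        ∫ t in Ioo 0 T, ∑' k, F k t := by
      refine setIntegral_congr_fun measurableSet_Ioo fun t ht => ?_
      have h1 := (modeBasis n).hasSum_inner_mul_inner (heatSol f t) v.1.fst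
      rw [heatSolH10_fst f ht.1, ← h1.tsum_eq, ← tsum_mul_left]
      refine tsum_congr fun k => ?_
      rw [modeBasis_apply, real_inner_comm]
      change deriv θ t * (coef (heatSol f t) k * coef v.1.fst k) = F k t
      rw [coef_heatSol f ht.1.le]
      ring
    have e2 : ∫ t in Ioo 0 T, θ t * (-dirichletForm n (heatSolH10 f t)) v =
        -∫ t in Ioo 0 T, ∑' k, G k t := by
      rw [← integral_neg]
      refine setIntegral_congr_fun measurableSet_Ioo fun t ht => ?_
      rw [_root_.neg_apply, ← (hasSum_dirichletForm_heatSolH10 f ht.1 v).tsum_eq,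
        mul_neg, ← tsum_mul_left]
      congr 1
      refine tsum_congr fun k => ?_
      simp only [hG, hc]
      ring
    rw [e1, e2, neg_neg]
    exact hF2.unique hG2
  · intro v
    refine .of_forall fun t => ?_
    rw [_root_.neg_apply, dirichletForm_apply, neg_add_cancel]

/-! ### The observability inequality -/

/-- For a time step `σ ≤ 1` there is a cutoff frequency `Lam` at which the two terms of the
estimate of the solution by an observation and by its value one step earlier are compatible with
the weights `exp (-D σ ^ (-γ))`, `γ = β / (1 - β)`. Here `B` stands for the supremum norm of the
eigenfunctions. -/
def CutoffBound (n : ℕ) (β B C D : ℝ) : Prop :=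
  ∀ σ : ℝ, 0 < σ → σ ≤ 1 → ∃ Lam : ℝ, 0 < Lam ∧
    2 / σ * (C * Real.exp (C * Lam ^ β)) ≤ Real.exp (D * σ ^ (-(β / (1 - β)))) ∧
    2 * (C * Real.exp (C * Lam ^ β)) * B * (4 / σ) ^ n * Real.exp (-(Lam * σ / 4)) ≤
      Real.exp (D * σ ^ (-(β / (1 - β)))) * Real.exp (-(D * (σ / 2) ^ (-(β / (1 - β)))))

/-- `Lam = (A / σ) ^ (1 / (1 - β))` balances `exp (C Lam ^ β)` against `exp (-Lam σ / 4)`: both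
exponents are then multiples of `σ ^ (-γ)` with `γ = β / (1 - β)`, and a large `A` lets the decay
win by any prescribed factor. -/
theorem exists_cutoff_frequency (n : ℕ) {B C β : ℝ} (hB : 0 < B) (hC : 1 ≤ C)
    (hβ : β ∈ Ioo (1 / 2 : ℝ) 1) :
    ∃ D : ℝ, 0 < D ∧ CutoffBound n β B C D := by
  obtain ⟨hβ1, hβ2⟩ := hβ
  have h1β : 0 < 1 - β := by linarith
  set γ := β / (1 - β) with hγ
  have hγ1 : 1 ≤ γ := by rw [hγ, le_div_iff₀ h1β]; linarith
  set q := 2 * C * B * 4 ^ n with hq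
  have hq0 : 0 < q := by positivity
  set A := 4 * (q + n + C + (3 * C + 1) * 2 ^ γ) with hA
  have h2γ : 0 < (2 : ℝ) ^ γ := by positivity
  have hA1 : 1 ≤ A := by
    have : 0 ≤ (3 * C + 1) * (2 : ℝ) ^ γ := by positivity
    have := Nat.cast_nonneg (α := ℝ) n
    rw [hA]
    linarith
  have hA0 : 0 < A := by linarith
  have hAγ : 1 ≤ A ^ γ := Real.one_le_rpow hA1 (by linarith)
  set D := 2 * C + 1 + C * A ^ γ with hD
  have hDle : D ≤ (3 * C + 1) * A ^ γ := by rw [hD]; nlinarith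
  refine ⟨D, by positivity, fun σ hσ hσ1 => ⟨(A / σ) ^ (1 / (1 - β)), by positivity, ?_⟩⟩
  set r := σ ^ (-γ) with hr
  have hr1 : 1 / σ ≤ r := by
    rw [hr, one_div, ← Real.rpow_neg_one]
    exact Real.rpow_le_rpow_of_exponent_ge hσ hσ1 (by linarith)
  have hr2 : 1 ≤ r := le_trans (by rw [le_div_iff₀ hσ]; linarith) hr1
  have hL : ((A / σ) ^ (1 / (1 - β))) ^ β = A ^ γ * r := by
    rw [← Real.rpow_mul (by positivity), show 1 / (1 - β) * β = γ by rw [hγ]; ring,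
      Real.div_rpow hA0.le hσ.le, hr, Real.rpow_neg hσ.le, div_eq_mul_inv]
  have hLσ : (A / σ) ^ (1 / (1 - β)) * σ = A * (A ^ γ * r) := by
    have e : 1 / (1 - β) = 1 + γ := by rw [hγ]; field_simp; ring
    rw [← hL, ← Real.rpow_mul (by positivity), show 1 / (1 - β) * β = γ by rw [hγ]; ring, e,
      Real.rpow_add (by positivity), Real.rpow_one]
    field_simp
  have hhalf : (σ / 2) ^ (-γ) = 2 ^ γ * r := by
    rw [Real.div_rpow hσ.le (by norm_num), Real.rpow_neg (by norm_num : (0 : ℝ) ≤ 2), hr]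
    field_simp
  have hrexp : ∀ a : ℝ, 0 ≤ a → a ≤ Real.exp (a * r) := fun a ha => by
    have h1 := Real.add_one_le_exp (a * r)
    nlinarith
  have hσexp : 1 / σ ≤ Real.exp r := hr1.trans (by linarith [Real.add_one_le_exp r])
  rw [hL, hhalf, show (A / σ) ^ (1 / (1 - β)) * σ / 4 = A * (A ^ γ * r) / 4 by rw [hLσ]]
  constructor
  · calc 2 / σ * (C * Real.exp (C * (A ^ γ * r)))
        = 1 / σ * (2 * C) * Real.exp (C * (A ^ γ * r)) := by ring
      _ ≤ Real.exp r * Real.exp (2 * C * r) * Real.exp (C * (A ^ γ * r)) := by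
          gcongr
          exact hrexp _ (by linarith)
      _ = Real.exp (D * r) := by
          rw [← Real.exp_add, ← Real.exp_add, hD]
          ring_nf
  · calc 2 * (C * Real.exp (C * (A ^ γ * r))) * B * (4 / σ) ^ n *
          Real.exp (-(A * (A ^ γ * r) / 4))
        = q * (1 / σ) ^ n * Real.exp (C * (A ^ γ * r)) * Real.exp (-(A * (A ^ γ * r) / 4)) := by
          rw [hq, div_pow, div_pow, one_pow]
          ring
      _ ≤ Real.exp (q * r) * Real.exp r ^ n * Real.exp (C * (A ^ γ * r)) *
          Real.exp (-(A * (A ^ γ * r) / 4)) := by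
          gcongr
          exact hrexp q hq0.le
      _ = Real.exp (q * r + n * r + C * (A ^ γ * r) - A * (A ^ γ * r) / 4) := by
          rw [← Real.exp_nat_mul, ← Real.exp_add, ← Real.exp_add, ← Real.exp_add]
          ring_nf
      _ ≤ Real.exp (D * r + -(D * (2 ^ γ * r))) := by
          rw [Real.exp_le_exp]
          have hr0 : 0 < r := by linarith
          have hDr : 0 ≤ D * r := by positivity
          have h1 : D * 2 ^ γ ≤ (3 * C + 1) * A ^ γ * 2 ^ γ := by gcongr
          have h2 : q + n + C * A ^ γ + D * 2 ^ γ ≤ A * A ^ γ / 4 := by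
            have hn := Nat.cast_nonneg (α := ℝ) n
            have h3 : A * A ^ γ / 4 =
              (q + n) * A ^ γ + C * A ^ γ + (3 * C + 1) * A ^ γ * 2 ^ γ := by
              rw [show A * A ^ γ / 4 = A / 4 * A ^ γ by ring,
                show A / 4 = q + n + C + (3 * C + 1) * 2 ^ γ by rw [hA]; ring]
              ring
            nlinarith
          nlinarith
      _ = _ := Real.exp_add _ _

/-- The supremum over `ω` of `F`, restricted to the cube and extended by zero. -/
def obsSup {n : ℕ} (α : ℝ) (F : BoundedContinuousFunction (E n) ℝ) : ℝ≥0∞ :=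
  ⨆ x ∈ omegaPow n α, ‖(cube n).indicator F x‖ₑ

/-- The low frequencies are observed by the spectral inequality, the high ones have decayed. -/
theorem enorm_heatFlow_le_obsSup {n : ℕ} {α β C : ℝ} (hα : 0 < α) (hC : 1 ≤ C)
    (hspec : SupSpecIneq n α β C)
    {τ Lam : ℝ} (hτ : 0 < τ) (hLam : 0 < Lam) (f : L2 (cube n)) :
    ‖heatFlow τ f‖ₑ ≤ ENNReal.ofReal (C * Real.exp (C * Lam ^ β)) * obsSup α (heatFlow τ f) +
      ENNReal.ofReal (2 * (C * Real.exp (C * Lam ^ β)) * √2 ^ n * (2 / τ) ^ n *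
        Real.exp (-(Lam * τ / 2))) * ‖f‖ₑ := by
  set F := heatFlow τ f with hF
  set low := ∑ k ∈ lowModes n Lam, (Real.exp (-(eigval k * τ)) * coef f k) • mode k with hlow
  set K := C * Real.exp (C * Lam ^ β) with hK
  have hK1 : 1 ≤ K := by
    have : 1 ≤ Real.exp (C * Lam ^ β) := Real.one_le_exp (by positivity)
    rw [hK]
    nlinarith
  set h := √2 ^ n * ‖f‖ * (2 / τ) ^ n * Real.exp (-(Lam * τ / 2)) with hh
  have hh0 : 0 ≤ h := by positivity
  have hhigh : ‖F - low‖ₑ ≤ ENNReal.ofReal h := by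
    rw [← ofReal_norm]
    exact ENNReal.ofReal_le_ofReal (norm_heatFlow_sub_low_le hτ f Lam)
  have hpt : ∀ (G : BoundedContinuousFunction (E n) ℝ) x, ‖G x‖ₑ ≤ ‖G‖ₑ := fun G x => by
    rw [← ofReal_norm, ← ofReal_norm]
    exact ENNReal.ofReal_le_ofReal (G.norm_coe_le_norm x)
  have hgrid : ∀ i, ‖low (gridPt α i)‖ₑ ≤ obsSup α F + ENNReal.ofReal h := by
    intro i
    have e : low (gridPt α i) = F (gridPt α i) - (F - low) (gridPt α i) := by simp
    rw [e]
    exact (enorm_sub_le).trans (add_le_add (enorm_gridPt_le_iSup hα F i)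
      ((hpt _ _).trans hhigh))
  have h1 := hspec Lam hLam _ _ hgrid
  have h2 : ENNReal.ofReal h ≤ ENNReal.ofReal K * ENNReal.ofReal h := by
    rw [← ENNReal.ofReal_mul (by linarith)]
    exact ENNReal.ofReal_le_ofReal (le_mul_of_one_le_left hh0 hK1)
  have e3 : ENNReal.ofReal (2 * K * √2 ^ n * (2 / τ) ^ n * Real.exp (-(Lam * τ / 2))) * ‖f‖ₑ =
      ENNReal.ofReal K * ENNReal.ofReal h + ENNReal.ofReal K * ENNReal.ofReal h := by
    rw [← ofReal_norm, ← ENNReal.ofReal_mul (by positivity), ← ENNReal.ofReal_mul (by linarith),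
      ← ENNReal.ofReal_add (by positivity) (by positivity)]
    congr 1
    rw [hh]
    ring
  calc ‖F‖ₑ = ‖low + (F - low)‖ₑ := by rw [add_sub_cancel]
    _ ≤ ‖low‖ₑ + ‖F - low‖ₑ := by
        rw [← ofReal_norm, ← ofReal_norm, ← ofReal_norm,
          ← ENNReal.ofReal_add (norm_nonneg _) (norm_nonneg _)]
        exact ENNReal.ofReal_le_ofReal (norm_add_le _ _)
    _ ≤ ENNReal.ofReal K * (obsSup α F + ENNReal.ofReal h) +
        ENNReal.ofReal K * ENNReal.ofReal h := add_le_add h1 (hhigh.trans h2)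
    _ = _ := by rw [e3, mul_add, add_assoc]

theorem norm_le_of_coef {n : ℕ} {τ : ℝ} (hτ : 0 ≤ τ) {f g : L2 (cube n)}
    (h : ∀ k, coef g k = Real.exp (-(eigval k * τ)) * coef f k) : ‖g‖ ≤ ‖f‖ := by
  refine (sq_le_sq₀ (norm_nonneg _) (norm_nonneg _)).1
    (hasSum_le (fun k => ?_) (hasSum_coef_sq g) (hasSum_coef_sq f))
  rw [h, mul_pow]
  refine mul_le_of_le_one_left (sq_nonneg _) (pow_le_one₀ (Real.exp_pos _).le ?_)
  exact Real.exp_le_one_iff.2 (by have := mul_nonneg (eigval_nonneg k) hτ; linarith)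

/-- One step of the telescoping: observation on `(s, s + σ]` improves the norm at time `s`,
with the weight `exp (-D (σ / 2) ^ (-γ))`, to the norm at time `s + σ`, with the weight
`exp (-D σ ^ (-γ))`. -/
theorem weighted_enorm_le_add {n : ℕ} {α β C D T : ℝ} (hα : 0 < α) (hC : 1 ≤ C)
    (hspec : SupSpecIneq n α β C)
    (hD : CutoffBound n β (√2 ^ n) C D)
    {u₀ : L2 (cube n)} {u : ℝ → L2 (cube n)}
    (hu : ∀ t ∈ Icc 0 T, ∀ k, coef (u t) k = Real.exp (-(eigval k * t)) * coef u₀ k)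
    {s σ : ℝ} (hs : 0 ≤ s) (hσ : 0 < σ) (hσ1 : σ ≤ 1) (hsT : s + σ ≤ T) :
    ENNReal.ofReal (Real.exp (-(D * σ ^ (-(β / (1 - β)))))) * ‖u (s + σ)‖ₑ ≤
      (∫⁻ t in Ioc s (s + σ), obsSup α (heatFlow t u₀)) +
      ENNReal.ofReal (Real.exp (-(D * (σ / 2) ^ (-(β / (1 - β)))))) * ‖u s‖ₑ := by
  obtain ⟨Lam, hLam, hL1, hL2⟩ := hD σ hσ hσ1
  set K := C * Real.exp (C * Lam ^ β) with hK
  have hK0 : 0 < K := by positivity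
  set c := 2 * K * √2 ^ n * (4 / σ) ^ n * Real.exp (-(Lam * σ / 4)) with hc
  set w := Real.exp (D * σ ^ (-(β / (1 - β)))) with hw
  set w' := Real.exp (-(D * (σ / 2) ^ (-(β / (1 - β))))) with hw'
  have hshift : ∀ a ∈ Icc 0 T, ∀ b ∈ Icc 0 T, ∀ k,
      coef (u b) k = Real.exp (-(eigval k * (b - a))) * coef (u a) k := by
    intro a ha b hb k
    rw [hu a ha, hu b hb, ← mul_assoc, ← Real.exp_add]
    ring_nf
  have hsI : s ∈ Icc 0 T := ⟨hs, by linarith⟩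
  have heI : s + σ ∈ Icc 0 T := ⟨by linarith, hsT⟩
  have hpt : ∀ t ∈ Ioc (s + σ / 2) (s + σ), ‖u (s + σ)‖ₑ ≤
      ENNReal.ofReal K * obsSup α (heatFlow t u₀) + ENNReal.ofReal c * ‖u s‖ₑ := by
    intro t ht
    have htI : t ∈ Icc 0 T := ⟨by linarith [ht.1], by linarith [ht.2]⟩
    have hτ : 0 < t - s := by linarith [ht.1]
    have e1 : heatFlow (t - s) (u s) = heatFlow t u₀ := by
      unfold heatFlow
      refine tsum_congr fun k => ?_
      rw [← hshift s hsI t htI k, hu t htI k]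
    have h1 : ‖u (s + σ)‖ₑ ≤ ‖u t‖ₑ := by
      rw [← ofReal_norm, ← ofReal_norm]
      exact ENNReal.ofReal_le_ofReal
        (norm_le_of_coef (sub_nonneg.2 ht.2) (hshift t htI (s + σ) heI))
    have h2 : ‖u t‖ₑ ≤ ‖heatFlow t u₀‖ₑ := by
      rw [heatFlow_coef_eq hτ (hshift s hsI t htI), e1]
      exact enorm_toL2_le _
    have h3 := enorm_heatFlow_le_obsSup hα hC hspec hτ hLam (u s)
    rw [e1] at h3
    refine h1.trans (h2.trans (h3.trans ?_))
    gcongr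
    rw [hc, ← hK]
    have h4 : 2 / (t - s) ≤ 4 / σ := by
      rw [div_le_div_iff₀ hτ hσ]
      linarith [ht.1]
    have h5 : Lam * σ / 4 ≤ Lam * (t - s) / 2 := by nlinarith [ht.1]
    gcongr
  set I := ∫⁻ t in Ioc s (s + σ), obsSup α (heatFlow t u₀) with hI
  have hint : ‖u (s + σ)‖ₑ * ENNReal.ofReal (σ / 2) ≤
      ENNReal.ofReal K * I + ENNReal.ofReal c * ‖u s‖ₑ * ENNReal.ofReal (σ / 2) := by
    have hvol : volume (Ioc (s + σ / 2) (s + σ)) = ENNReal.ofReal (σ / 2) := by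
      rw [Real.volume_Ioc]; congr 1; ring
    calc ‖u (s + σ)‖ₑ * ENNReal.ofReal (σ / 2)
        = ∫⁻ _t in Ioc (s + σ / 2) (s + σ), ‖u (s + σ)‖ₑ := by
          rw [setLIntegral_const, hvol]
      _ ≤ ∫⁻ t in Ioc (s + σ / 2) (s + σ),
          (ENNReal.ofReal K * obsSup α (heatFlow t u₀) + ENNReal.ofReal c * ‖u s‖ₑ) :=
          setLIntegral_mono' measurableSet_Ioc hpt
      _ = ENNReal.ofReal K * (∫⁻ t in Ioc (s + σ / 2) (s + σ), obsSup α (heatFlow t u₀)) +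
          ENNReal.ofReal c * ‖u s‖ₑ * ENNReal.ofReal (σ / 2) := by
          rw [lintegral_add_right _ measurable_const, setLIntegral_const, hvol,
            lintegral_const_mul' _ _ ENNReal.ofReal_ne_top]
      _ ≤ _ := by
          gcongr
          exact lintegral_mono_set (Ioc_subset_Ioc_left (by linarith))
  have hone : ENNReal.ofReal (σ / 2) * ENNReal.ofReal (2 / σ) = 1 := by
    rw [← ENNReal.ofReal_mul (by positivity), show σ / 2 * (2 / σ) = 1 by field_simp,
      ENNReal.ofReal_one]
  have hwpos : 0 < w := Real.exp_pos _
  have hwinv : Real.exp (-(D * σ ^ (-(β / (1 - β))))) = w⁻¹ := Real.exp_neg _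
  rw [hwinv]
  have hX : ‖u (s + σ)‖ₑ ≤ ENNReal.ofReal w * I + ENNReal.ofReal (w * w') * ‖u s‖ₑ := by
    calc ‖u (s + σ)‖ₑ = ‖u (s + σ)‖ₑ * ENNReal.ofReal (σ / 2) * ENNReal.ofReal (2 / σ) := by
          rw [mul_assoc, hone, mul_one]
      _ ≤ (ENNReal.ofReal K * I + ENNReal.ofReal c * ‖u s‖ₑ * ENNReal.ofReal (σ / 2)) *
          ENNReal.ofReal (2 / σ) := by gcongr
      _ = ENNReal.ofReal (2 / σ * K) * I + ENNReal.ofReal c * ‖u s‖ₑ := by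
          rw [add_mul, mul_assoc _ (ENNReal.ofReal (σ / 2)), hone, mul_one,
            ENNReal.ofReal_mul (p := 2 / σ) (by positivity)]
          ring
      _ ≤ _ := by gcongr
  calc ENNReal.ofReal w⁻¹ * ‖u (s + σ)‖ₑ
      ≤ ENNReal.ofReal w⁻¹ * (ENNReal.ofReal w * I + ENNReal.ofReal (w * w') * ‖u s‖ₑ) := by gcongr
    _ = I + ENNReal.ofReal w' * ‖u s‖ₑ := by
        rw [mul_add, ← mul_assoc, ← mul_assoc, ← ENNReal.ofReal_mul (by positivity),
          ← ENNReal.ofReal_mul (by positivity), ← mul_assoc, inv_mul_cancel₀ hwpos.ne',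
          ENNReal.ofReal_one, one_mul, one_mul]

/-- Summation of the steps over the dyadic times `S / 2 ^ m`. -/
theorem weighted_enorm_le_lintegral {n : ℕ} {α β C D T : ℝ} (hα : 0 < α) (hC : 1 ≤ C) (hD0 : 0 < D)
    (hβ : β ∈ Ioo (1 / 2 : ℝ) 1)
    (hspec : SupSpecIneq n α β C)
    (hD : CutoffBound n β (√2 ^ n) C D)
    {u₀ : L2 (cube n)} {u : ℝ → L2 (cube n)}
    (hu : ∀ t ∈ Icc 0 T, ∀ k, coef (u t) k = Real.exp (-(eigval k * t)) * coef u₀ k)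
    {S : ℝ} (hS : 0 < S) (hS1 : S ≤ 1) (hST : S ≤ T) :
    ENNReal.ofReal (Real.exp (-(D * (S / 2) ^ (-(β / (1 - β)))))) * ‖u S‖ₑ ≤
      ∫⁻ t in Ioc 0 S, obsSup α (heatFlow t u₀) := by
  set γ := β / (1 - β) with hγ
  have hγ0 : 0 < γ := div_pos (by linarith [hβ.1]) (by linarith [hβ.2])
  set p : ℕ → ℝ := fun m => S * (1 / 2) ^ m with hp
  have hp0 : ∀ m, 0 < p m := fun m => by positivity
  have hpS : ∀ m, p m ≤ S := fun m =>
    mul_le_of_le_one_right hS.le (pow_le_one₀ (by norm_num) (by norm_num))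
  have hps : ∀ m, p (m + 1) = p m / 2 := fun m => by simp only [hp, pow_succ]; ring
  set a : ℕ → ℝ≥0∞ := fun m => ENNReal.ofReal (Real.exp (-(D * (p m / 2) ^ (-γ)))) * ‖u (p m)‖ₑ
    with ha
  have hstep : ∀ m, a m ≤ (∫⁻ t in Ioc (p (m + 1)) (p m), obsSup α (heatFlow t u₀)) + a (m + 1) := by
    intro m
    have h := weighted_enorm_le_add hα hC hspec hD hu (s := p m / 2) (σ := p m / 2)
      (half_pos (hp0 m)).le (half_pos (hp0 m)) (by linarith [hpS m, hp0 m])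
      (by linarith [hpS m])
    rw [add_halves] at h
    simp only [ha, hps]
    exact h
  have hsum : ∀ m, a 0 ≤ (∫⁻ t in Ioc (p m) S, obsSup α (heatFlow t u₀)) + a m := by
    intro m
    induction m with
    | zero => exact le_add_self
    | succ m ih =>
      refine ih.trans ((add_le_add_right (hstep m) _).trans (le_of_eq ?_))
      rw [← add_assoc]
      congr 1
      rw [← Ioc_union_Ioc_eq_Ioc (a := p (m + 1)) (b := p m) (c := S)
        (by rw [hps]; linarith [hp0 m]) (hpS m),
        lintegral_union measurableSet_Ioc (Ioc_disjoint_Ioc_of_le le_rfl), add_comm]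
  have hle : ∀ m, a 0 ≤ (∫⁻ t in Ioc 0 S, obsSup α (heatFlow t u₀)) +
      ENNReal.ofReal (Real.exp (-(D * (p m / 2) ^ (-γ))) * ‖u₀‖) := by
    intro m
    refine (hsum m).trans (add_le_add (lintegral_mono_set (Ioc_subset_Ioc_left (hp0 m).le)) ?_)
    simp only [ha]
    rw [ENNReal.ofReal_mul (Real.exp_pos _).le, ← ofReal_norm]
    gcongr
    exact norm_le_of_coef (hp0 m).le (hu _ ⟨(hp0 m).le, (hpS m).trans hST⟩)
  have hlim : Filter.Tendsto (fun m => (∫⁻ t in Ioc 0 S, obsSup α (heatFlow t u₀)) +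
      ENNReal.ofReal (Real.exp (-(D * (p m / 2) ^ (-γ))) * ‖u₀‖)) Filter.atTop
      (𝓝 ((∫⁻ t in Ioc 0 S, obsSup α (heatFlow t u₀)) + ENNReal.ofReal (0 * ‖u₀‖))) := by
    refine tendsto_const_nhds.add (ENNReal.tendsto_ofReal (Filter.Tendsto.mul_const _ ?_))
    refine Real.tendsto_exp_neg_atTop_nhds_zero.comp (Filter.Tendsto.const_mul_atTop hD0 ?_)
    refine (tendsto_rpow_neg_nhdsGT_zero (by linarith : -γ < 0)).comp ?_
    refine tendsto_nhdsWithin_iff.2 ⟨?_, .of_forall fun m => half_pos (hp0 m)⟩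
    have h1 := ((tendsto_pow_atTop_nhds_zero_of_lt_one (by norm_num : (0 : ℝ) ≤ 1 / 2)
      (by norm_num)).const_mul S).div_const 2
    simpa [hp] using h1
  rw [zero_mul, ENNReal.ofReal_zero, add_zero] at hlim
  have h0 := ge_of_tendsto' hlim hle
  simpa [ha, hp] using h0

theorem exists_obsIneq (n : ℕ) {α β : ℝ} (hα : 0 < α) (hβ : β ∈ Ioo (1 / 2 : ℝ) 1) :
    ∃ C : ℝ, 0 < C ∧ ∀ T : ℝ, 0 < T → ∀ (u₀ : L2 (cube n)) (u : ℝ → L2 (cube n)),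
      IsHeatSolution (cube n) T u₀ u →
      ObsIneq (cube n) (omegaPow n α) T (C * Real.exp (C / T ^ (β / (1 - β)))) u := by
  obtain ⟨C, hC, hspec⟩ := exists_supSpecIneq n hα hβ.1
  obtain ⟨D, hD0, hD⟩ := exists_cutoff_frequency n (B := √2 ^ n) (by positivity) hC hβ
  have h1β : 0 < 1 - β := by linarith [hβ.2]
  set γ := β / (1 - β) with hγ
  have hγ1 : 1 ≤ γ := by rw [hγ, le_div_iff₀ h1β]; linarith [hβ.1]
  set Q := (n + D * 2 ^ γ) * 2 ^ γ with hQ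
  have hQ0 : 0 < Q := by positivity
  set M := √2 ^ n * Real.exp Q + Q with hM
  refine ⟨M, by positivity, fun T hT u₀ u hsol => ?_⟩
  have hu : ∀ t ∈ Icc 0 T, ∀ k, coef (u t) k = Real.exp (-(eigval k * t)) * coef u₀ k :=
    fun t ht k => hsol.coef_eq hT k t ht
  refine ⟨fun t => (cube n).indicator (heatFlow t u₀), fun t ht => ?_, ?_⟩
  · rw [heatFlow_coef_eq ht.1 (hu t ⟨ht.1.le, ht.2⟩)]
    exact isPointwiseRep_indicator _
  set S := min T 1 / 2 with hS
  have hm0 : 0 < min T 1 := lt_min hT one_pos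
  have hS0 : 0 < S := half_pos hm0
  have hST : S ≤ T / 2 := by
    have := min_le_left T 1
    rw [hS]; linarith
  have hS1 : S ≤ 1 := by
    have := min_le_right T 1
    rw [hS]; linarith
  have hobs := weighted_enorm_le_lintegral hα hC hD0 hβ hspec hD hu hS0 hS1 (by linarith)
  set I := ∫⁻ t in Ioc 0 T, obsSup α (heatFlow t u₀) with hI
  have hI' : ENNReal.ofReal (Real.exp (-(D * (S / 2) ^ (-γ)))) * ‖u S‖ₑ ≤ I :=
    hobs.trans (lintegral_mono_set (Ioc_subset_Ioc_right (by linarith)))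
  have hSI : S ∈ Icc 0 T := ⟨hS0.le, by linarith⟩
  have huS : ‖u S‖ₑ ≤ ENNReal.ofReal (Real.exp (D * (S / 2) ^ (-γ))) * I := by
    calc ‖u S‖ₑ = ENNReal.ofReal (Real.exp (D * (S / 2) ^ (-γ))) *
          (ENNReal.ofReal (Real.exp (-(D * (S / 2) ^ (-γ)))) * ‖u S‖ₑ) := by
          rw [← mul_assoc, ← ENNReal.ofReal_mul (Real.exp_pos _).le, ← Real.exp_add, add_neg_cancel,
            Real.exp_zero, ENNReal.ofReal_one, one_mul]
      _ ≤ _ := by gcongr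
  have hTS : 0 < T - S := by linarith
  have huT : u T = toL2 n (heatFlow (T - S) (u S)) := heatFlow_coef_eq hTS fun k => by
    rw [hu T ⟨hT.le, le_rfl⟩, hu S hSI, ← mul_assoc, ← Real.exp_add]
    ring_nf
  have hsup : eLpNorm (u T) ∞ (volume.restrict (cube n)) ≤ ‖heatFlow (T - S) (u S)‖ₑ := by
    rw [huT, eLpNorm_congr_ae (coeFn_toL2 _), eLpNorm_exponent_top]
    refine eLpNormEssSup_le_of_ae_enorm_bound (.of_forall fun x => ?_)
    rw [← ofReal_norm, ← ofReal_norm]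
    exact ENNReal.ofReal_le_ofReal (BoundedContinuousFunction.norm_coe_le_norm _ x)
  have hsmooth : ‖heatFlow (T - S) (u S)‖ₑ ≤ ENNReal.ofReal (√2 ^ n * (1 / S) ^ n) * ‖u S‖ₑ := by
    rw [← ofReal_norm, ← ofReal_norm, ← ENNReal.ofReal_mul (by positivity)]
    refine ENNReal.ofReal_le_ofReal ((norm_heatFlow_le hTS (u S)).trans ?_)
    have h1 : 1 / (T - S) ≤ 1 / S := one_div_le_one_div_of_le hS0 (by linarith)
    calc √2 ^ n * ‖u S‖ * (1 / (T - S)) ^ n ≤ √2 ^ n * ‖u S‖ * (1 / S) ^ n := by gcongr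
      _ = _ := by ring
  have hconst : √2 ^ n * (1 / S) ^ n * Real.exp (D * (S / 2) ^ (-γ)) ≤
      M * Real.exp (M / T ^ γ) := by
    have h2γ : 0 < (2 : ℝ) ^ γ := by positivity
    have hhalf : (S / 2) ^ (-γ) = 2 ^ γ * S ^ (-γ) := by
      rw [Real.div_rpow hS0.le (by norm_num), Real.rpow_neg (by norm_num : (0 : ℝ) ≤ 2)]
      field_simp
    have hSγ : S ^ (-γ) ≤ 2 ^ γ * (1 + 1 / T ^ γ) := by
      have e : S ^ (-γ) = 2 ^ γ * (min T 1) ^ (-γ) := by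
        rw [hS, Real.div_rpow hm0.le (by norm_num), Real.rpow_neg (by norm_num : (0 : ℝ) ≤ 2)]
        field_simp
      rw [e]
      refine mul_le_mul_of_nonneg_left ?_ h2γ.le
      have hTγ : 0 < 1 / T ^ γ := by positivity
      rcases min_cases T 1 with ⟨h, -⟩ | ⟨h, -⟩
      · rw [h, Real.rpow_neg hT.le, one_div]; linarith
      · rw [h, Real.one_rpow]; linarith
    have h1S : 1 / S ≤ Real.exp (S ^ (-γ)) := by
      have h1 : 1 / S ≤ S ^ (-γ) := by
        rw [one_div, ← Real.rpow_neg_one]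
        exact Real.rpow_le_rpow_of_exponent_ge hS0 hS1 (by linarith)
      exact h1.trans (by linarith [Real.add_one_le_exp (S ^ (-γ))])
    have hT0 : 0 < T ^ γ := by positivity
    calc √2 ^ n * (1 / S) ^ n * Real.exp (D * (S / 2) ^ (-γ))
        ≤ √2 ^ n * Real.exp (S ^ (-γ)) ^ n * Real.exp (D * (S / 2) ^ (-γ)) := by gcongr
      _ = √2 ^ n * Real.exp ((n + D * 2 ^ γ) * S ^ (-γ)) := by
          rw [mul_assoc, ← Real.exp_nat_mul, ← Real.exp_add, hhalf]
          ring_nf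
      _ ≤ √2 ^ n * Real.exp ((n + D * 2 ^ γ) * (2 ^ γ * (1 + 1 / T ^ γ))) := by gcongr
      _ = √2 ^ n * Real.exp Q * Real.exp (Q / T ^ γ) := by
          rw [mul_assoc (√2 ^ n), ← Real.exp_add, hQ]
          ring_nf
      _ ≤ M * Real.exp (M / T ^ γ) := by
          have h1 : 0 ≤ √2 ^ n * Real.exp Q := by positivity
          gcongr <;> rw [hM] <;> linarith
  calc eLpNorm (u T) ∞ (volume.restrict (cube n))
      ≤ ENNReal.ofReal (√2 ^ n * (1 / S) ^ n) *
          (ENNReal.ofReal (Real.exp (D * (S / 2) ^ (-γ))) * I) :=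
        hsup.trans (hsmooth.trans (mul_le_mul_right huS _))
    _ = ENNReal.ofReal (√2 ^ n * (1 / S) ^ n * Real.exp (D * (S / 2) ^ (-γ))) * I := by
        rw [← mul_assoc, ← ENNReal.ofReal_mul (by positivity)]
    _ ≤ ENNReal.ofReal (M * Real.exp (M / T ^ γ)) * I := by gcongr

theorem countable_omegaPow (n : ℕ) (α : ℝ) : (omegaPow n α).Countable := by
  have h1 : (omegaSet α).Countable := by
    refine (countable_range fun i : ℕ => (i : ℝ) ^ (-α)).mono ?_
    rintro y ⟨i, -, rfl⟩
    exact ⟨i, rfl⟩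
  have h2 : omegaPow n α ⊆ (WithLp.toLp 2) '' (univ.pi fun _ : Fin n => omegaSet α) :=
    fun x hx => ⟨x.ofLp, fun j _ => hx j, rfl⟩
  exact ((countable_univ_pi fun _ => h1).image _).mono h2

end HeatObs

end

theorem mainTheorem8 (n : ℕ) (hn : 1 ≤ n) (α : ℝ) (hα : 0 < α) (β : ℝ)
    (hβ : β ∈ Set.Ioo (1 / 2 : ℝ) 1) :
    ((HeatObs.omegaPow n α).Countable ∧ dimH (HeatObs.omegaPow n α) = 0) ∧
    (∃ C : ℝ, 0 < C ∧ HeatObs.SpecIneq (HeatObs.cube n) (HeatObs.omegaPow n α) C β) ∧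
    (∃ C : ℝ, 0 < C ∧ ∀ T : ℝ, 0 < T → ∀ u₀ : HeatObs.L2 (HeatObs.cube n),
      (∃ u : ℝ → HeatObs.L2 (HeatObs.cube n), HeatObs.IsHeatSolution (HeatObs.cube n) T u₀ u) ∧
      ∀ u : ℝ → HeatObs.L2 (HeatObs.cube n), HeatObs.IsHeatSolution (HeatObs.cube n) T u₀ u →
        HeatObs.ObsIneq (HeatObs.cube n) (HeatObs.omegaPow n α) T
          (C * Real.exp (C / T ^ (β / (1 - β)))) u) := by
  refine ⟨⟨HeatObs.countable_omegaPow n α, (HeatObs.countable_omegaPow n α).dimH_zero⟩,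
    HeatObs.exists_specIneq n hα hβ.1, ?_⟩
  obtain ⟨C, hC, h⟩ := HeatObs.exists_obsIneq n hα hβ
  exact ⟨C, hC, fun T hT u₀ => ⟨⟨_, HeatObs.isHeatSolution_heatSol hT u₀⟩, h T hT u₀⟩⟩
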